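/- **Setting.** Let $B$ be a Bratteli diagram with a top vertex $v_0$ (level $0$), whose vertices at every level $n\ge 1$ are $\{1,\dots,d\}$. Every level has finitely many edges, every vertex is the source of an edge, and every vertex other than $v_0$ is the range of an edge. Write $r(e)$ for the range of an edge $e$, and $F_n=(f^{(n)}_{v,w})$ for the incidence matrices: $f^{(n)}_{v,w}$, $n\ge 1$, is the number of edges from $w$ at level $n$ to $v$ at level $n+1$. Let $X_B$ be the space of infinite paths $x=(x_1,x_2,\dots)$ from $v_0$, with the topology generated by the cylinder sets $[\bar e]$ ($\bar e$ a finite path from $v_0$), and let $X_v^{(n)}=\{x\in X_B: r(x_n)=v\}$. Paths $x,y$ are tail equivalent if $x_n=y_n$ for all large $n$. All measures are non-atomic Borel measures. A measure $\mu$ is *invariant* if $\mu([\bar e])=\mu([\bar e'])$ whenever $\bar e,\bar e'$ end at the same vertex of the same level. An *ergodic measure* is a $\sigma$-finite invariant measure, finite or infinite, which takes a finite non-zero value on some clopen set and for which every Borel set saturated for tail equivalence is null or co-null. A diagram is *simple* if for each $n$ there is $m>n$ such that every vertex of level $n$ is joined to every vertex of level $m$ by a finite path; it is *uniquely ergodic*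 if it has exactly one invariant probability measure. For $W\subset\{1,\dots,d\}$, the *vertical subdiagram* on $W$ consists of $v_0$, the vertices of $W$ at all levels $n\ge 1$, and all edges of $B$ connecting them; $Y_W\subset X_B$ is its path space and $X_W$ the set of all paths tail equivalent to a path of $Y_W$. An *extension* of a measure $\mu$ on $Y_W$ is an invariant measure $\nu$ on $X_B$ with $\nu(X_B\setminus X_W)=0$ and $\nu|_{Y_W}=\mu$. *Block-triangular form* means: $\{1,\dots,d\}$ is divided into consecutive non-empty blocks $1,\dots,m$, and there is $s\le m$ such that for all $n\ge1$: $F_n$ is block lower triangular; in the block rows $1,\dots,s$ only the diagonal blocks $F_\alpha^{(n)}$ are non-zero, and they are strictly positive; for each $\alpha>s$ the diagonal blocks $F_\alpha^{(n)}$ are either strictly positive for all $n$ or zero for all $n$; and each block row $\alpha>s$ has a non-zero block to the left of the diagonal. Let $\Lambda$ be the set of $\alpha$ with $F_\alpha^{(n)}\neq0$, and for $\alpha\in\Lambda$ let $Y_\alpha$ be the path space of the vertical subdiagram on block $\alpha$ and $X_\alpha$ the set of paths tail equivalent to a path of $Y_\alpha$. **Theorem.** (1) If $B$ is in block-triangular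 form and $\alpha\in\Lambda$, every finite ergodic measure on $Y_\alpha$ has a unique extension, supported on $X_\alpha$; this extension is an ergodic measure, of finite or infinite total mass. (2) If $B$ is in block-triangular form, every ergodic measure on $X_B$, finite or infinite, is the extension of a finite ergodic measure on $Y_\alpha$ for some $\alpha\in\Lambda$. (3) Up to positive scalar multiples, there are at most $d$ ergodic measures on $X_B$, finite and infinite ones together. (4) There are levels $0=n_0<n_1<n_2<\cdots$ such that, after telescoping $B$ to these levels (the edges of the telescoped diagram $B'$ are the finite paths between consecutive chosen levels, and $X_{B'}$ is identified with $X_B$), for every ergodic probability measure $\mu$ there is a set $W_\mu\subset\{1,\dots,d\}$ such that, with all notions taken in $B'$, $\mu$ is supported on the set of all infinite paths that eventually go through vertices of $W_\mu$ only, and moreover: (4-i) $W_\mu\cap W_\nu=\emptyset$ for different ergodic probability measures $\mu,\nu$; (4-ii) for each $\mu$ there is $\delta>0$ with $\mu(X_v^{(n)})\ge\delta$ for all $v\in W_\mu$ and all levels $n\ge1$; (4-iii) the vertical subdiagram on $W_\mu$ is a simple and uniquely ergodic Bratteli diagram; the restriction of $\mu$ to its path space is an ergodic measure, and every ergodic measure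 on that path space is a positive multiple of it. (5) If an ergodic probability measure $\mu$ on $X_B$ is the extension of a measure from the path space of the vertical subdiagram on a proper subset $W\subset\{1,\dots,d\}$, then $\lim_{n\to\infty}\mu(X_v^{(n)})=0$ for all $v\notin W$. -/

import Mathlib

open MeasureTheory Filter Topology
open scoped NNReal ENNReal

/-- A graph with vertex levels `V 0, V 1, …` and edge levels `E 0, E 1, …`, where `E n` is the set
of edges from level `n` to level `n + 1`.  The vertices of level `n` are named by elements of a
label type `L`; the same label may be used on several levels, and it then names different
vertices. -/
structure LevelGraph (L : Type) where
  V : ℕ → Set L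
  E : ℕ → Type
  src : (n : ℕ) → E n → L
  rng : (n : ℕ) → E n → L
  src_mem : ∀ n e, src n e ∈ V n
  rng_mem : ∀ n e, rng n e ∈ V (n + 1)

namespace LevelGraph

variable {L : Type}

/-- Bratteli diagrams: a single top vertex, finite levels, every vertex is the source of an edge and
every vertex except the top one is the range of an edge. -/
structure IsBratteli (B : LevelGraph L) : Prop where
  root : ∃ v₀, B.V 0 = {v₀}
  finite_V : ∀ n, (B.V n).Finite
  finite_E : ∀ n, Finite (B.E n)
  exists_src : ∀ n, ∀ v ∈ B.V n, ∃ e, B.src n e = v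
  exists_rng : ∀ n, ∀ v ∈ B.V (n + 1), ∃ e, B.rng n e = v

/-- The incidence matrix between the levels `n` and `n + 1`: the entry at `(v, w)` is the number of
edges from the vertex `w` of level `n` to the vertex `v` of level `n + 1`. -/
noncomputable def incidence (B : LevelGraph L) (n : ℕ) : Matrix L L ℕ :=
  fun v w => Nat.card {e : B.E n // B.rng n e = v ∧ B.src n e = w}

/-! ### Finite and infinite paths -/

/-- Finite paths from level `a` to level `b`. -/
def FinPath (B : LevelGraph L) (a b : ℕ) : Type :=
  {p : (i : Set.Ico a b) → B.E i //
    ∀ (i : ℕ) (h : i ∈ Set.Ico a b) (h' : i + 1 ∈ Set.Ico a b),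
      B.rng i (p ⟨i, h⟩) = B.src (i + 1) (p ⟨i + 1, h'⟩)}

/-- The vertex of level `a` where a path from level `a` to level `b` starts. -/
def FinPath.start {B : LevelGraph L} {a b : ℕ} (h : a < b) (p : B.FinPath a b) : L :=
  B.src a (p.1 ⟨a, le_rfl, h⟩)

/-- The vertex of level `b` where a path from level `a` to level `b` ends. -/
def FinPath.finish {B : LevelGraph L} {a b : ℕ} (h : a < b) (p : B.FinPath a b) : L :=
  B.rng (b - 1) (p.1 ⟨b - 1, Nat.le_sub_one_of_lt h, Nat.sub_one_lt_of_lt h⟩)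

/-- The path space: infinite paths starting at level `0`. -/
def Path (B : LevelGraph L) : Type :=
  {x : (n : ℕ) → B.E n // ∀ n, B.rng n (x n) = B.src (n + 1) (x (n + 1))}

/-- The topology generated by the cylinder sets, i.e. the one induced by the product of the discrete
topologies on the edge sets. -/
instance (B : LevelGraph L) : TopologicalSpace B.Path :=
  TopologicalSpace.induced Subtype.val (@Pi.topologicalSpace ℕ B.E fun _ => ⊥)

instance (B : LevelGraph L) : MeasurableSpace B.Path := borel _

instance (B : LevelGraph L) : BorelSpace B.Path := ⟨rfl⟩

/-- Tail (cofinal) equivalence. -/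
def TailEquiv (B : LevelGraph L) (x y : B.Path) : Prop :=
  ∀ᶠ n in atTop, x.1 n = y.1 n

/-- The cylinder set of all infinite paths that begin with a given finite path. -/
def cylinder (B : LevelGraph L) {n : ℕ} (e : B.FinPath 0 n) : Set B.Path :=
  {x | ∀ i : Set.Ico 0 n, x.1 i = e.1 i}

/-- The set `X_v^{(n+1)}` of all infinite paths that go through the vertex `v` at level `n + 1`. -/
def tower (B : LevelGraph L) (n : ℕ) (v : L) : Set B.Path :=
  {x | B.rng n (x.1 n) = v}

/-- Simple diagrams: for every level `n` there is `m > n` such that every vertex of level `n` is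
connected by a finite path to every vertex of level `m`. -/
def IsSimple (B : LevelGraph L) : Prop :=
  ∀ n, ∃ m, ∃ h : n < m, ∀ v ∈ B.V n, ∀ w ∈ B.V m,
    ∃ p : B.FinPath n m, p.start h = v ∧ p.finish h = w

/-! ### Invariant measures -/

/-- Invariance: the cylinder sets of two finite paths from the top vertex with the same range have
the same measure. -/
def IsInvariant (B : LevelGraph L) (μ : Measure B.Path) : Prop :=
  ∀ (n : ℕ) (e e' : B.FinPath 0 (n + 1)),
    e.finish n.succ_pos = e'.finish n.succ_pos → μ (B.cylinder e) = μ (B.cylinder e')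

/-- Ergodic measures, finite or infinite: non-atomic `σ`-finite invariant Borel measures, finite and
non-zero on some clopen set (for a non-zero finite measure this holds for the whole space), such
that every Borel set that is saturated for tail equivalence is null or co-null. -/
structure IsErgodicMeasure (B : LevelGraph L) (μ : Measure B.Path) : Prop where
  nonatomic : NullSingletonClass μ
  sigmaFinite : SigmaFinite μ
  exists_clopen : ∃ C : Set B.Path, IsClopen C ∧ μ C ≠ 0 ∧ μ C ≠ ∞
  invariant : B.IsInvariant μ
  ergodic : ∀ A : Set B.Path, MeasurableSet A →
    (∀ x y, B.TailEquiv x y → x ∈ A → y ∈ A) → μ A = 0 ∨ μ Aᶜ = 0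

/-- There is exactly one (non-atomic) invariant probability measure. -/
def IsUniquelyErgodic (B : LevelGraph L) : Prop :=
  ∃! μ : Measure B.Path, IsProbabilityMeasure μ ∧ NullSingletonClass μ ∧ B.IsInvariant μ

/-! ### Subdiagrams and extension of measures -/

/-- The subgraph formed by the vertices of `W n`, `n ≥ 0`, and all edges that connect them. It is
called a subdiagram if it is a Bratteli diagram. -/
def sub (B : LevelGraph L) (W : ℕ → Set L) : LevelGraph L where
  V n := B.V n ∩ W n
  E n := {e : B.E n // B.src n e ∈ W n ∧ B.rng n e ∈ W (n + 1)}
  src n e := B.src n e.1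
  rng n e := B.rng n e.1
  src_mem n e := ⟨B.src_mem n e.1, e.2.1⟩
  rng_mem n e := ⟨B.rng_mem n e.1, e.2.2⟩

/-- The vertical subgraph: the top vertex, and the vertices of `W` at every level `n ≥ 1`. -/
def vertical (B : LevelGraph L) (W : Set L) : LevelGraph L :=
  B.sub fun n => if n = 0 then Set.univ else W

/-- The path space of a subgraph, seen inside the path space of the whole graph. -/
def incl (B : LevelGraph L) (W : ℕ → Set L) (x : (B.sub W).Path) : B.Path :=
  ⟨fun n => (x.1 n).1, x.2⟩

/-- The inclusion `incl` for a vertical subgraph. -/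
def verticalIncl (B : LevelGraph L) (W : Set L) : (B.vertical W).Path → B.Path :=
  B.incl _

/-- The saturation, with respect to tail equivalence, of the path space of a vertical subgraph. -/
def saturation (B : LevelGraph L) (W : Set L) : Set B.Path :=
  {x | ∃ y : (B.vertical W).Path, B.TailEquiv x (B.verticalIncl W y)}

/-- `ν` is the extension of the measure `μ` on the path space of a vertical subgraph: it is
invariant, lives on the saturation of that path space, and restricts to `μ` on it. -/
structure IsExtension (B : LevelGraph L) (W : Set L) (ν : Measure B.Path)
    (μ : Measure (B.vertical W).Path) : Prop where
  invariant : B.IsInvariant ν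
  saturation_compl : ν (B.saturation W)ᶜ = 0
  restriction : ν.comap (B.verticalIncl W) = μ

/-! ### Telescoping -/

/-- Telescoping to the levels `m 0 < m 1 < …`: the new edges are the finite paths between
consecutive levels `m k` and `m (k + 1)`. -/
def telescope (B : LevelGraph L) (m : ℕ → ℕ) (hm : StrictMono m) : LevelGraph L where
  V k := B.V (m k)
  E k := B.FinPath (m k) (m (k + 1))
  src k p := p.start (hm k.lt_succ_self)
  rng k p := p.finish (hm k.lt_succ_self)
  src_mem k p := B.src_mem _ _
  rng_mem k p := by
    have h := B.rng_mem _ (p.1 ⟨m (k + 1) - 1, Nat.le_sub_one_of_lt (hm k.lt_succ_self),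
      Nat.sub_one_lt_of_lt (hm k.lt_succ_self)⟩)
    have h1 : m (k + 1) - 1 + 1 = m (k + 1) :=
      Nat.sub_add_cancel (Nat.one_le_of_lt (hm k.lt_succ_self))
    rw [h1] at h
    exact h

/-- The natural identification of the path space of a diagram (for `m 0 = 0`) with the path space of
its telescoping: an infinite path is cut at the levels `m k`. -/
def telescopeMap (B : LevelGraph L) (m : ℕ → ℕ) (hm : StrictMono m) (x : B.Path) :
    (B.telescope m hm).Path :=
  ⟨fun _ => ⟨fun i => x.1 i, fun i _ _ => x.2 i⟩, fun k => by
    have h : ∀ j, 0 < j → B.rng (j - 1) (x.1 (j - 1)) = B.src j (x.1 j) := by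
      intro j hj
      obtain ⟨i, rfl⟩ := Nat.exists_eq_succ_of_ne_zero hj.ne'
      exact x.2 i
    exact h (m (k + 1)) (Nat.zero_lt_of_lt (hm k.lt_succ_self))⟩

/-! ### Block-triangular form -/

/-- The diagonal block `α` of the incidence matrices consists of non-zero matrices; here `b v` is the
block that the vertex `v` belongs to. -/
def IsNonzeroBlock (B : LevelGraph L) {r : ℕ} (b : L → Fin r) (α : Fin r) : Prop :=
  ∀ n, 1 ≤ n → ∃ v w, b v = α ∧ b w = α ∧ B.incidence n v w ≠ 0

/-- The incidence matrices `F_n`, `n ≥ 1`, have block-triangular form with `r` blocks, the first `s`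
of which are the blocks of the minimal components. -/
structure IsBlockTriangular {d : ℕ} (B : LevelGraph (Fin d)) {r : ℕ} (s : ℕ)
    (b : Fin d → Fin r) : Prop where
  le : s ≤ r
  surjective : Function.Surjective b
  monotone : Monotone b
  /-- The matrices are block lower triangular. -/
  upper_zero : ∀ n, 1 ≤ n → ∀ v w, b v < b w → B.incidence n v w = 0
  /-- In the first `s` block rows only the diagonal block is non-zero. -/
  min_zero : ∀ n, 1 ≤ n → ∀ v w, (b v : ℕ) < s → b w ≠ b v → B.incidence n v w = 0
  /-- The first `s` diagonal blocks are strictly positive. -/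
  min_pos : ∀ n, 1 ≤ n → ∀ v w, (b v : ℕ) < s → b w = b v → 0 < B.incidence n v w
  /-- Each of the other diagonal blocks is strictly positive at all levels or zero at all levels. -/
  pos_or_zero : ∀ α : Fin r, s ≤ (α : ℕ) →
    (∀ n, 1 ≤ n → ∀ v w, b v = α → b w = α → 0 < B.incidence n v w) ∨
    (∀ n, 1 ≤ n → ∀ v w, b v = α → b w = α → B.incidence n v w = 0)
  /-- In each of the other block rows some block to the left of the diagonal is non-zero. -/
  off_diag : ∀ n, 1 ≤ n → ∀ α : Fin r, s ≤ (α : ℕ) →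
    ∃ v w, b v = α ∧ b w < α ∧ B.incidence n v w ≠ 0

end LevelGraph

/-!
The proof works with infinite paths. A cylinder is written as `x.cyl n`, the set of the paths that
share the first `n` edges of `x`; `x.vtx n` is the vertex of `x` at level `n`, and
`Path.splice n x y` follows `x` up to level `n` and `y` afterwards. Invariance of `ν` says that
`ν (x.cyl n)` depends only on `n` and `x.vtx n`.

The main tool is asymptotic independence. The Borel sets that depend only on the edges from level
`n` on form a decreasing sequence of σ-algebras, whose intersection consists of tail saturated sets
and is therefore trivial for an ergodic measure `ν`. Hence, by convergence of orthogonal projections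
in `L²`, every event inside a cylinder of finite measure is asymptotically independent of the event
of passing through a vertex `v` at level `n`, as `n → ∞`
(`IsErgodicMeasure.tendsto_inter_through`). On the other hand, the way in which the paths through
`v` are distributed among the cylinders of lower levels is given by numbers of finite paths, and so
is the same for all invariant measures (`IsBratteli.measure_cross_mul`). Consequently, if a label
`v` keeps a definite proportion of some cylinder along the same filter of levels for two ergodic
measures, then the weights of both are the limits of the same ratios and the measures are
proportional (`IsErgodicMeasure.exists_smul_eq`). For an ultrafilter of levels every ergodic measure
has such a label, because there are finitely many labels; this bounds the number of ergodic measures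
by `d`, infinite ones included.

For an ergodic probability measure `μ`, let `W` be the set of all labels that keep a definite
proportion along the ultrafilter. These sets are disjoint for different measures. Asymptotic
independence also shows that the vertices in `W` of one level are joined by finite paths to those of
most later levels, so that levels can be selected from the ultrafilter for which these connections
exist and the proportions outside `W` are summable (`exists_levels`). By the Borel-Cantelli lemma
`μ` lives on the paths that eventually stay in `W`; by asymptotic independence the vertices in `W`
still have a definite proportion for the restriction of `μ` to the path space of the subdiagram, and
the comparison of weights gives unique ergodicity (`IsErgodicMeasure.vertical_uniquelyErgodic`).

In a diagram of block-triangular form the block of the vertex of a path is non-decreasing, so each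
path eventually stays in one block, and an ergodic measure selects a single block. Positivity of the
diagonal block makes the measure finite on the path space of the block, and exchange of initial
segments shows that the restriction is ergodic. Conversely, a finite ergodic measure on the path
space of a block is extended by summing its images over all finite paths that enter the block at
their last vertex (`IsErgodicMeasure.exists_extension`). Since paths never return to a block, the
cylinders that end in the block have the prescribed finite measure, so that the extension is
σ-finite and unique (`IsExtension.unique`).
-/

/-! ### Asymptotic independence for a decreasing sequence of σ-algebras -/

section Mixing

variable {Ω : Type*} {m0 : MeasurableSpace Ω} {ρ : Measure Ω}

/-- A function that is, for every `n`, almost everywhere equal to a `𝒯 n`-measurable function is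
almost everywhere constant if the intersection of the antitone sequence `𝒯` is trivial. -/
theorem ae_eq_const_of_trivial_iInf {𝒯 : ℕ → MeasurableSpace Ω} (h𝒯 : Antitone 𝒯)
    (htriv : ∀ A, (∀ n, MeasurableSet[𝒯 n] A) → ρ A = 0 ∨ ρ Aᶜ = 0)
    {h : Ω → ℝ} (hh : ∀ n, AEStronglyMeasurable[𝒯 n] h ρ) : ∃ c, h =ᵐ[ρ] fun _ => c := by
  choose g hg hhg using hh
  -- The upper limit of the versions `g n` is exactly measurable for every `𝒯 n`.
  set G : Ω → ℝ := fun x => limsup (fun n => g n x) atTop with hG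
  have hGm : ∀ n, Measurable[𝒯 n] G := by
    intro n
    have h1 : G = fun x => limsup (fun i => g (i + n) x) atTop := by
      funext x
      exact (limsup_nat_add (fun i => g i x) n).symm
    rw [h1]
    exact Measurable.limsup (mδ := 𝒯 n)
      fun i => ((hg (i + n)).measurable).mono (h𝒯 (Nat.le_add_left _ _)) le_rfl
  have hGh : h =ᵐ[ρ] G := by
    filter_upwards [ae_all_iff.2 hhg] with x hx
    have : (fun n => g n x) = fun _ => h x := funext fun n => (hx n).symm
    simp only [hG, this, limsup_const]
  obtain ⟨c, hc⟩ := exists_eventuallyEq_const_of_forall_separating (l := ae ρ) (f := G)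
    MeasurableSet (by
      intro U hU
      rcases htriv (G ⁻¹' U) (fun n => hGm n hU) with h0 | h0
      · exact Or.inr (measure_eq_zero_iff_ae_notMem.1 h0)
      · refine Or.inl ?_
        filter_upwards [measure_eq_zero_iff_ae_notMem.1 h0] with x hx
        exact not_not.1 hx)
  exact ⟨c, hGh.trans hc⟩

/-- If an antitone sequence `𝒯` of σ-algebras has trivial intersection, then any event is
asymptotically independent of events taken from `𝒯 n`, as `n → ∞`.  The conditional expectations
given `𝒯 n` are projections onto a decreasing sequence of closed subspaces of `L²`, so they converge
to the projection onto the constants. -/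
theorem tendsto_measureReal_inter_of_trivial_iInf [IsFiniteMeasure ρ] {𝒯 : ℕ → MeasurableSpace Ω}
    (hle : ∀ n, 𝒯 n ≤ m0) (h𝒯 : Antitone 𝒯)
    (htriv : ∀ A, (∀ n, MeasurableSet[𝒯 n] A) → ρ A = 0 ∨ ρ Aᶜ = 0)
    {A : Set Ω} (hA : MeasurableSet A) {T : ℕ → Set Ω} (hT : ∀ n, MeasurableSet[𝒯 n] (T n)) :
    Tendsto (fun n => ρ.real (A ∩ T n) * ρ.real Set.univ - ρ.real A * ρ.real (T n)) atTop
      (𝓝 0) := by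
  let one : ∀ {S : Set Ω}, MeasurableSet S → Lp ℝ 2 ρ := fun hS =>
    indicatorConstLp 2 hS (measure_ne_top ρ _) (1 : ℝ)
  set u : Lp ℝ 2 ρ := ρ.real Set.univ • one hA - ρ.real A • one MeasurableSet.univ with hu
  let K : ℕ → Submodule ℝ (Lp ℝ 2 ρ) := fun n => lpMeas ℝ ℝ (𝒯 n) 2 ρ
  have hcomplete : ∀ n, CompleteSpace (K n) := fun n => by
    have : Fact (𝒯 n ≤ m0) := ⟨hle n⟩
    exact inferInstanceAs (CompleteSpace (lpMeas ℝ ℝ (𝒯 n) 2 ρ))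
  have hinner : ∀ {S S' : Set Ω} (hS : MeasurableSet S) (hS' : MeasurableSet S'),
      inner ℝ (one hS) (one hS') = ρ.real (S ∩ S') := fun hS hS' => by
    have := L2.inner_indicatorConstLp_one_indicatorConstLp_one (𝕜 := ℝ) (μ := ρ) hS hS'
      (measure_ne_top ρ _) (measure_ne_top ρ _)
    simpa using this
  have hKanti : Antitone K := by
    intro i j hij f hf
    exact AEStronglyMeasurable.mono (h𝒯 hij) (mem_lpMeas_iff_aestronglyMeasurable.1 hf)
  have hmono : Monotone fun n => (K n)ᗮ := fun i j hij => Submodule.orthogonal_le (hKanti hij)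
  -- `u` is orthogonal to the constants, and these are the intersection of the subspaces `K n`
  have hmem : u ∈ (⨆ n, (K n)ᗮ).topologicalClosure := by
    rw [← Submodule.orthogonal_orthogonal_eq_closure, ← Submodule.iInf_orthogonal]
    rw [Submodule.mem_orthogonal]
    intro f hf
    have hf' : ∀ n, AEStronglyMeasurable[𝒯 n] f ρ := by
      intro n
      have h1 := (Submodule.mem_iInf _).1 hf n
      rw [Submodule.orthogonal_orthogonal] at h1
      exact mem_lpMeas_iff_aestronglyMeasurable.1 h1
    obtain ⟨c, hc⟩ := ae_eq_const_of_trivial_iInf h𝒯 htriv hf'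
    have hfc : f = c • one MeasurableSet.univ := by
      refine Lp.ext ?_
      have h2 : (one MeasurableSet.univ : Lp ℝ 2 ρ) =ᵐ[ρ] Set.univ.indicator fun _ => (1 : ℝ) :=
        indicatorConstLp_coeFn
      filter_upwards [hc, Lp.coeFn_smul c (one MeasurableSet.univ : Lp ℝ 2 ρ), h2]
        with x hx h3 h4
      rw [hx, h3, Pi.smul_apply, h4]
      simp
    rw [hfc, hu, inner_smul_left, inner_sub_right, inner_smul_right, inner_smul_right, hinner,
      hinner]
    simp [mul_comm]
  have hlim : Tendsto (fun n => (K n).starProjection u) atTop (𝓝 0) := by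
    have h1 := Submodule.starProjection_tendsto_closure_iSup _ hmono u
    rw [Submodule.starProjection_eq_self_iff.2 hmem] at h1
    have h2 : (fun n => (K n).starProjection u) = fun n => u - (K n)ᗮ.starProjection u := by
      funext n
      rw [Submodule.starProjection_orthogonal_val, sub_sub_cancel]
    rw [h2]
    simpa using h1.const_sub u
  have hbound : ∀ n, ‖ρ.real (A ∩ T n) * ρ.real Set.univ - ρ.real A * ρ.real (T n)‖ ≤
      ‖(K n).starProjection u‖ * ρ.real Set.univ ^ (1 / (2 : ℝ)) := by
    intro n
    have hTn : MeasurableSet (T n) := hle n _ (hT n)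
    have h1 : ρ.real (A ∩ T n) * ρ.real Set.univ - ρ.real A * ρ.real (T n) =
        inner ℝ u (one hTn) := by
      rw [hu, inner_sub_left, inner_smul_left, inner_smul_left, hinner, hinner]
      simp [mul_comm]
    have hK : one hTn ∈ K n := mem_lpMeas_indicatorConstLp (hle n) (hT n) (measure_ne_top ρ _)
    have h2 : inner ℝ u (one hTn) = inner ℝ ((K n).starProjection u) (one hTn) := by
      rw [Submodule.inner_starProjection_left_eq_right, Submodule.starProjection_eq_self_iff.2 hK]
    rw [h1, h2]
    refine (norm_inner_le_norm _ _).trans (mul_le_mul_of_nonneg_left ?_ (norm_nonneg _))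
    refine norm_indicatorConstLp_le.trans ?_
    simp only [norm_one, one_mul, ENNReal.toReal_ofNat]
    exact Real.rpow_le_rpow measureReal_nonneg (measureReal_mono (Set.subset_univ _)) (by norm_num)
  refine squeeze_zero_norm hbound ?_
  simpa using (hlim.norm).mul_const (ρ.real Set.univ ^ (1 / (2 : ℝ)))

end Mixing

namespace LevelGraph

variable {L : Type} {B : LevelGraph L}

/-! ### Vertices, cylinders and splicing of infinite paths -/

/-- The vertex of level `n` on an infinite path. -/
def Path.vtx (x : B.Path) (n : ℕ) : L := B.src n (x.1 n)

/-- The cylinder of all paths that have the same first `n` edges as `x`. -/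
def Path.cyl (x : B.Path) (n : ℕ) : Set B.Path := {y | ∀ i < n, y.1 i = x.1 i}

/-- The set of all infinite paths through the vertex `v` of level `n`. -/
def through (B : LevelGraph L) (n : ℕ) (v : L) : Set B.Path := {x | x.vtx n = v}

open Classical in
/-- The path that follows `x` up to level `n` and `y` from there on.  If `x` and `y` do not meet at
level `n`, the value is `y`. -/
noncomputable def Path.splice (n : ℕ) (x y : B.Path) : B.Path :=
  if h : x.vtx n = y.vtx n then
    ⟨fun i => if i < n then x.1 i else y.1 i, fun i => by
      rcases lt_trichotomy (i + 1) n with h1 | h1 | h1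
      · simp only [h1, (Nat.lt_succ_self i).trans h1, if_true]
        exact x.2 i
      · subst h1
        simp only [Nat.lt_succ_self, lt_irrefl, if_true, if_false]
        exact (x.2 i).trans h
      · have h2 : ¬ i < n := by omega
        simp only [h2, not_lt.2 h1.le, if_false]
        exact y.2 i⟩
  else y

theorem Path.rng_eq_vtx (x : B.Path) (n : ℕ) : B.rng n (x.1 n) = x.vtx (n + 1) := x.2 n

theorem tower_eq_through (B : LevelGraph L) (n : ℕ) (v : L) : B.tower n v = B.through (n + 1) v :=
  Set.ext fun x => by
    change B.rng n (x.1 n) = v ↔ x.vtx (n + 1) = v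
    rw [x.rng_eq_vtx]

theorem Path.vtx_mem (x : B.Path) (n : ℕ) : x.vtx n ∈ B.V n := B.src_mem n _

theorem Path.splice_apply_lt {n : ℕ} {x y : B.Path} (h : x.vtx n = y.vtx n) {i : ℕ} (hi : i < n) :
    (Path.splice n x y).1 i = x.1 i := by
  simp [Path.splice, h, hi]

theorem Path.splice_apply_ge (n : ℕ) (x y : B.Path) {i : ℕ} (hi : n ≤ i) :
    (Path.splice n x y).1 i = y.1 i := by
  by_cases h : x.vtx n = y.vtx n
  · simp [Path.splice, h, not_lt.2 hi]
  · simp [Path.splice, h]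

theorem Path.vtx_splice_ge (n : ℕ) (x y : B.Path) {i : ℕ} (hi : n ≤ i) :
    (Path.splice n x y).vtx i = y.vtx i := by
  simp only [Path.vtx, Path.splice_apply_ge n x y hi]

theorem Path.vtx_splice_le {n : ℕ} {x y : B.Path} (h : x.vtx n = y.vtx n) {i : ℕ} (hi : i ≤ n) :
    (Path.splice n x y).vtx i = x.vtx i := by
  rcases hi.lt_or_eq with h1 | rfl
  · simp only [Path.vtx, Path.splice_apply_lt h h1]
  · rw [Path.vtx_splice_ge _ x y le_rfl, h]

theorem Path.mem_cyl_self (x : B.Path) (n : ℕ) : x ∈ x.cyl n := fun _ _ => rfl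

theorem Path.splice_mem_cyl {n : ℕ} {x y : B.Path} (h : x.vtx n = y.vtx n) :
    Path.splice n x y ∈ x.cyl n := fun _ hi => Path.splice_apply_lt h hi

theorem Path.cyl_anti (x : B.Path) {m n : ℕ} (h : m ≤ n) : x.cyl n ⊆ x.cyl m :=
  fun _ hy i hi => hy i (hi.trans_le h)

theorem Path.cyl_eq {n : ℕ} {x y : B.Path} (h : y ∈ x.cyl n) : y.cyl n = x.cyl n :=
  Set.ext fun _ => ⟨fun hz i hi => (hz i hi).trans (h i hi),
    fun hz i hi => (hz i hi).trans (h i hi).symm⟩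

theorem Path.mem_cyl_symm {n : ℕ} {x y : B.Path} (h : y ∈ x.cyl n) : x ∈ y.cyl n :=
  fun i hi => (h i hi).symm

theorem Path.cyl_zero (x : B.Path) : x.cyl 0 = Set.univ :=
  Set.eq_univ_of_forall fun _ _ hi => absurd hi (Nat.not_lt_zero _)

theorem Path.ext {x y : B.Path} (h : ∀ i, x.1 i = y.1 i) : x = y := Subtype.ext (funext h)

theorem IsBratteli.vtx_zero (hB : B.IsBratteli) (x y : B.Path) : x.vtx 0 = y.vtx 0 := by
  obtain ⟨v₀, h⟩ := hB.root
  have hx := x.vtx_mem 0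
  have hy := y.vtx_mem 0
  rw [h] at hx hy
  exact (Set.mem_singleton_iff.1 hx).trans (Set.mem_singleton_iff.1 hy).symm

theorem IsBratteli.vtx_of_mem_cyl (hB : B.IsBratteli) {x y : B.Path} {n m : ℕ} (h : y ∈ x.cyl n)
    (hm : m ≤ n) : y.vtx m = x.vtx m := by
  rcases m with _ | m
  · exact hB.vtx_zero y x
  · rw [← y.rng_eq_vtx, ← x.rng_eq_vtx, h m hm]

/-- Replacing the first `n` edges of `x` by those of `y` carries cylinders to cylinders. -/
theorem IsBratteli.cyl_inter_preimage_splice (hB : B.IsBratteli) {n m : ℕ} {x y z : B.Path}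
    (h : x.vtx n = y.vtx n) (hz : z ∈ y.cyl n) (hnm : n ≤ m) :
    x.cyl n ∩ Path.splice n y ⁻¹' z.cyl m = (Path.splice n x z).cyl m := by
  have hxz : x.vtx n = z.vtx n := h.trans (hB.vtx_of_mem_cyl hz le_rfl).symm
  ext w
  constructor
  · rintro ⟨hw, hw'⟩ i hi
    rcases lt_or_ge i n with hin | hin
    · rw [hw i hin, Path.splice_apply_lt hxz hin]
    · rw [Path.splice_apply_ge _ _ _ hin, ← hw' i hi, Path.splice_apply_ge _ _ _ hin]
  · intro hw
    have hwx : w ∈ x.cyl n := fun i hi => by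
      rw [hw i (hi.trans_le hnm), Path.splice_apply_lt hxz hi]
    have hyw : y.vtx n = w.vtx n := by rw [hB.vtx_of_mem_cyl hwx le_rfl, h]
    refine ⟨hwx, fun i hi => ?_⟩
    rcases lt_or_ge i n with hin | hin
    · rw [Path.splice_apply_lt hyw hin, hz i hin]
    · rw [Path.splice_apply_ge _ _ _ hin, hw i hi, Path.splice_apply_ge _ _ _ hin]

/-! ### Existence of paths -/

/-- Every finite path extends to an infinite one; here the finite path is given by the first `n`
edges of a path `x` and one more edge `e`. -/
theorem IsBratteli.exists_extend (hB : B.IsBratteli) (x : B.Path) (n : ℕ) (e : B.E n)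
    (he : B.src n e = x.vtx n) : ∃ z ∈ x.cyl n, z.1 n = e := by
  classical
  choose out hout using hB.exists_src
  let z : (i : ℕ) → B.E i := fun i => Nat.rec (motive := fun i => B.E i)
    (Function.update x.1 n e 0)
    (fun i zi => if i + 1 ≤ n then Function.update x.1 n e (i + 1)
      else out (i + 1) (B.rng i zi) (B.rng_mem i zi)) i
  have hz : ∀ i ≤ n, z i = Function.update x.1 n e i := by
    intro i hi
    rcases i with _ | i
    · rfl
    · exact if_pos hi
  have hz' : ∀ i, n ≤ i → z (i + 1) = out (i + 1) (B.rng i (z i)) (B.rng_mem i _) :=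
    fun i hi => if_neg (by omega)
  refine ⟨⟨z, fun i => ?_⟩, fun i hi => ?_, ?_⟩
  · rcases lt_or_ge i n with hi | hi
    · rw [hz i hi.le, hz (i + 1) hi, Function.update_of_ne hi.ne, x.2 i]
      rcases (Nat.succ_le_of_lt hi).lt_or_eq with h1 | h1
      · rw [Function.update_of_ne (show i + 1 ≠ n from h1.ne)]
      · have h2 : i + 1 = n := h1
        subst h2
        rw [Function.update_self, he]
        rfl
    · rw [hz' i hi, hout]
  · change z i = x.1 i
    rw [hz i hi.le, Function.update_of_ne hi.ne]
  · change z n = e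
    rw [hz n le_rfl, Function.update_self]

theorem IsBratteli.nonempty_path (hB : B.IsBratteli) : Nonempty B.Path := by
  choose out hout using hB.exists_src
  obtain ⟨v₀, hv⟩ := hB.root
  let s : (i : ℕ) → {v // v ∈ B.V i} := fun i => Nat.rec (motive := fun i => {v // v ∈ B.V i})
    ⟨v₀, by rw [hv]; rfl⟩ (fun i si => ⟨B.rng i (out i si.1 si.2), B.rng_mem i _⟩) i
  exact ⟨⟨fun i => out i (s i).1 (s i).2, fun i => (hout (i + 1) (s (i + 1)).1 (s (i + 1)).2).symm⟩⟩

theorem IsBratteli.exists_vtx_eq (hB : B.IsBratteli) (n : ℕ) {v : L} (hv : v ∈ B.V n) :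
    ∃ x : B.Path, x.vtx n = v := by
  induction n generalizing v with
  | zero =>
    obtain ⟨x⟩ := hB.nonempty_path
    obtain ⟨v₀, h⟩ := hB.root
    have hx := x.vtx_mem 0
    rw [h] at hx hv
    exact ⟨x, (Set.mem_singleton_iff.1 hx).trans (Set.mem_singleton_iff.1 hv).symm⟩
  | succ n ih =>
    obtain ⟨e, rfl⟩ := hB.exists_rng n v hv
    obtain ⟨x, hx⟩ := ih (B.src_mem n e)
    obtain ⟨z, -, hz⟩ := hB.exists_extend x n e hx.symm
    exact ⟨z, by rw [← z.rng_eq_vtx, hz]⟩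

theorem IsBratteli.exists_mem_cylinder (hB : B.IsBratteli) {n : ℕ} (e : B.FinPath 0 (n + 1)) :
    ∃ x : B.Path, B.cylinder e = x.cyl (n + 1) ∧ x.vtx (n + 1) = e.finish n.succ_pos := by
  obtain ⟨z, hz⟩ := hB.exists_vtx_eq (n + 1) (v := e.finish n.succ_pos) (B.rng_mem n _)
  let x : B.Path := ⟨fun i => if h : i < n + 1 then e.1 ⟨i, i.zero_le, h⟩ else z.1 i, fun i => by
    rcases lt_trichotomy i n with hi | rfl | hi
    · simp only [hi.trans (Nat.lt_succ_self n), Nat.succ_lt_succ hi, dif_pos]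
      exact e.2 i _ _
    · simp only [lt_irrefl, Nat.lt_succ_self, dif_pos, dif_neg, not_false_eq_true]
      exact hz.symm
    · have h1 : ¬ i < n + 1 := by omega
      have h2 : ¬ i + 1 < n + 1 := by omega
      simp only [h1, h2, dif_neg, not_false_eq_true]
      exact z.2 i⟩
  have hx : ∀ i (h : i < n + 1), x.1 i = e.1 ⟨i, i.zero_le, h⟩ := fun i h => dif_pos h
  refine ⟨x, Set.ext fun y => ⟨fun hy i hi => ?_, fun hy i => ?_⟩, ?_⟩
  · rw [hx i hi]
    exact hy ⟨i, i.zero_le, hi⟩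
  · exact (hy i.1 i.2.2).trans (hx i.1 i.2.2)
  · rw [← x.rng_eq_vtx, hx n n.lt_succ_self]
    rfl

/-- The cylinder of the finite initial segment of an infinite path. -/
theorem Path.exists_cylinder_eq (x : B.Path) (n : ℕ) : ∃ e : B.FinPath 0 (n + 1),
    B.cylinder e = x.cyl (n + 1) ∧ e.finish n.succ_pos = x.vtx (n + 1) :=
  ⟨⟨fun i => x.1 i, fun i _ _ => x.2 i⟩, Set.ext fun _ =>
    ⟨fun h i hi => h ⟨i, i.zero_le, hi⟩, fun h i => h i.1 i.2.2⟩, x.rng_eq_vtx n⟩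

/-- Invariance in terms of cylinders of infinite paths. -/
theorem IsBratteli.isInvariant_iff (hB : B.IsBratteli) {μ : Measure B.Path} :
    B.IsInvariant μ ↔
      ∀ (n : ℕ) (x y : B.Path), x.vtx n = y.vtx n → μ (x.cyl n) = μ (y.cyl n) := by
  constructor
  · intro h n x y hxy
    rcases n with _ | n
    · rw [x.cyl_zero, y.cyl_zero]
    · obtain ⟨e, he, he'⟩ := x.exists_cylinder_eq n
      obtain ⟨f, hf, hf'⟩ := y.exists_cylinder_eq n
      rw [← he, ← hf]
      exact h n e f (by rw [he', hf', hxy])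
  · intro h n e f hef
    obtain ⟨x, hx, hx'⟩ := hB.exists_mem_cylinder e
    obtain ⟨y, hy, hy'⟩ := hB.exists_mem_cylinder f
    rw [hx, hy]
    exact h _ _ _ (by rw [hx', hy', hef])

/-! ### The Borel structure of the path space -/

theorem isOpen_coord (n : ℕ) (S : Set (B.E n)) : IsOpen {x : B.Path | x.1 n ∈ S} := by
  let _ : ∀ i, TopologicalSpace (B.E i) := fun _ => ⊥
  have : ∀ i, DiscreteTopology (B.E i) := fun _ => ⟨rfl⟩
  exact ((isOpen_discrete S).preimage (continuous_apply n)).preimage continuous_induced_dom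

theorem isOpen_cyl (x : B.Path) (n : ℕ) : IsOpen (x.cyl n) := by
  have : x.cyl n = ⋂ i ∈ Finset.range n, {y : B.Path | y.1 i ∈ ({x.1 i} : Set (B.E i))} := by
    ext y
    simp [Path.cyl]
  rw [this]
  exact isOpen_biInter_finset fun i _ => isOpen_coord i _

theorem measurableSet_coord (n : ℕ) (S : Set (B.E n)) : MeasurableSet {x : B.Path | x.1 n ∈ S} :=
  (isOpen_coord n S).measurableSet

theorem measurableSet_cyl (x : B.Path) (n : ℕ) : MeasurableSet (x.cyl n) :=
  (isOpen_cyl x n).measurableSet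

theorem measurableSet_vtx (n : ℕ) (S : Set L) : MeasurableSet {x : B.Path | x.vtx n ∈ S} :=
  measurableSet_coord n (B.src n ⁻¹' S)

theorem measurableSet_through (n : ℕ) (v : L) : MeasurableSet (B.through n v) :=
  measurableSet_vtx n {v}

theorem exists_cyl_subset {U : Set B.Path} (hU : IsOpen U) {x : B.Path} (hx : x ∈ U) :
    ∃ n, x.cyl n ⊆ U := by
  let _ : ∀ i, TopologicalSpace (B.E i) := fun _ => ⊥
  obtain ⟨U', hU', rfl⟩ := isOpen_induced_iff.1 hU
  obtain ⟨I, u, hu, hsub⟩ := isOpen_pi_iff.1 hU' x.1 hx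
  refine ⟨I.sup id + 1, fun y hy => hsub fun i hi => ?_⟩
  rw [hy i (Nat.lt_succ_of_le (Finset.le_sup (f := id) hi))]
  exact (hu i hi).2

theorem measurableSet_path_singleton (x : B.Path) : MeasurableSet {x} := by
  have : {x} = ⋂ n, x.cyl n := by
    ext y
    rw [Set.mem_iInter]
    exact ⟨fun h n => h ▸ y.mem_cyl_self n,
      fun h => Path.ext fun i => h (i + 1) i i.lt_succ_self⟩
  rw [this]
  exact MeasurableSet.iInter fun n => measurableSet_cyl _ _

/-- The first `n` edges of a path. -/
def Path.pre (n : ℕ) (x : B.Path) : (i : Fin n) → B.E i := fun i => x.1 i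

theorem Path.cyl_eq_preimage (x : B.Path) (n : ℕ) : x.cyl n = Path.pre n ⁻¹' {Path.pre n x} :=
  Set.ext fun _ => ⟨fun h => funext fun i => h i.1 i.2, fun h i hi => congrFun h ⟨i, hi⟩⟩

theorem IsBratteli.finite_pre (hB : B.IsBratteli) (n : ℕ) : Finite ((i : Fin n) → B.E i) :=
  have := hB.finite_E
  inferInstance

theorem IsBratteli.finite_range_cyl (hB : B.IsBratteli) (n : ℕ) :
    (Set.range fun x : B.Path => x.cyl n).Finite := by
  have := hB.finite_pre n
  refine (Set.finite_range fun c : (i : Fin n) → B.E i =>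
    (Path.pre n ⁻¹' {c} : Set B.Path)).subset ?_
  rintro _ ⟨x, rfl⟩
  exact ⟨Path.pre n x, (x.cyl_eq_preimage n).symm⟩

/-- The family of all cylinders. -/
def cylinders (B : LevelGraph L) : Set (Set B.Path) := {s | ∃ (x : B.Path) (n : ℕ), s = x.cyl n}

theorem IsBratteli.countable_cylinders (hB : B.IsBratteli) : B.cylinders.Countable := by
  have : B.cylinders = ⋃ n, Set.range fun x : B.Path => x.cyl n := by
    ext s
    simp only [cylinders, Set.mem_ofPred_eq, Set.mem_iUnion, Set.mem_range]
    exact ⟨fun ⟨x, n, h⟩ => ⟨n, x, h.symm⟩, fun ⟨n, x, h⟩ => ⟨x, n, h.symm⟩⟩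
  rw [this]
  exact Set.countable_iUnion fun n => (hB.finite_range_cyl n).countable

theorem IsBratteli.borel_eq_generateFrom (hB : B.IsBratteli) :
    (inferInstance : MeasurableSpace B.Path) = MeasurableSpace.generateFrom B.cylinders := by
  have hbasis : TopologicalSpace.IsTopologicalBasis B.cylinders := by
    refine TopologicalSpace.isTopologicalBasis_of_isOpen_of_nhds ?_ ?_
    · rintro _ ⟨x, n, rfl⟩
      exact isOpen_cyl x n
    · intro x U hx hU
      obtain ⟨n, hn⟩ := exists_cyl_subset hU hx
      exact ⟨_, ⟨x, n, rfl⟩, x.mem_cyl_self n, hn⟩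
  have := hbasis.secondCountableTopology hB.countable_cylinders
  exact hbasis.borel_eq_generateFrom

theorem IsBratteli.measurable_of_coord (hB : B.IsBratteli) {Z : Type*} [MeasurableSpace Z]
    {f : Z → B.Path} (hf : ∀ n e, MeasurableSet {z | (f z).1 n = e}) : Measurable f := by
  refine Measurable.mono (measurable_generateFrom (s := B.cylinders) ?_) le_rfl
    hB.borel_eq_generateFrom.le
  rintro _ ⟨x, n, rfl⟩
  have : f ⁻¹' x.cyl n = ⋂ i ∈ Finset.range n, {z | (f z).1 i = x.1 i} := by
    ext z
    simp [Path.cyl]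
  rw [this]
  exact Finset.measurableSet_biInter _ fun i _ => hf i _

theorem IsBratteli.measurable_splice (hB : B.IsBratteli) (n : ℕ) (y : B.Path) :
    Measurable (Path.splice n y) := by
  refine hB.measurable_of_coord fun i e => ?_
  by_cases hi : i < n
  · have : {z : B.Path | (Path.splice n y z).1 i = e} =
        (B.through n (y.vtx n) ∩ {_z | y.1 i = e}) ∪
          ((B.through n (y.vtx n))ᶜ ∩ {z : B.Path | z.1 i ∈ ({e} : Set _)}) := by
      ext z
      by_cases h : y.vtx n = z.vtx n
      · simp [Path.splice_apply_lt h hi, through, h]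
      · simp [Path.splice, through, h, eq_comm]
    rw [this]
    exact ((measurableSet_through _ _).inter (MeasurableSet.const _)).union
      ((measurableSet_through _ _).compl.inter (measurableSet_coord _ _))
  · simp only [Path.splice_apply_ge n y _ (not_lt.1 hi)]
    exact measurableSet_coord i {e}

theorem isPiSystem_cylinders (B : LevelGraph L) : IsPiSystem B.cylinders := by
  rintro _ ⟨x, n, rfl⟩ _ ⟨y, m, rfl⟩ ⟨z, hzx, hzy⟩
  rw [← Path.cyl_eq hzx, ← Path.cyl_eq hzy]
  rcases le_total n m with h | h
  · exact ⟨z, m, Set.inter_eq_right.2 (z.cyl_anti h)⟩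
  · exact ⟨z, n, Set.inter_eq_left.2 (z.cyl_anti h)⟩

/-- Two measures agree if they agree, with finite values, on the cylinders inside an increasing
sequence of sets `G m`, where `G m` is a union of cylinders of level `m` and the union of the
sequence is co-null for both measures. -/
theorem IsBratteli.measure_ext (hB : B.IsBratteli) {μ ν : Measure B.Path} {G : ℕ → Set B.Path}
    (hmono : Monotone G) (hG : ∀ m, ∀ x ∈ G m, x.cyl m ⊆ G m)
    (hfin : ∀ m, ∀ x ∈ G m, μ (x.cyl m) ≠ ∞) (heq : ∀ m, ∀ x ∈ G m, μ (x.cyl m) = ν (x.cyl m))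
    (hμ : μ (⋃ m, G m)ᶜ = 0) (hν : ν (⋃ m, G m)ᶜ = 0) : μ = ν := by
  have hrestr : ∀ m, μ.restrict (G m) = ν.restrict (G m) := by
    intro m
    have hU : G m = ⋃₀ ((fun x : B.Path => x.cyl m) '' G m) := by
      ext x
      constructor
      · intro hx
        exact ⟨_, ⟨x, hx, rfl⟩, x.mem_cyl_self m⟩
      · rintro ⟨_, ⟨y, hy, rfl⟩, hx⟩
        exact hG m y hy hx
    rw [hU, Measure.restrict_sUnion_congr
      ((hB.finite_range_cyl m).subset (Set.image_subset_range _ _)).countable]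
    rintro _ ⟨x, hx, rfl⟩
    have : IsFiniteMeasure (μ.restrict (x.cyl m)) := ⟨by
      rw [Measure.restrict_apply_univ]
      exact (hfin m x hx).lt_top⟩
    refine ext_of_generate_finite B.cylinders hB.borel_eq_generateFrom B.isPiSystem_cylinders ?_ ?_
    · rintro _ ⟨z, n, rfl⟩
      rw [Measure.restrict_apply (measurableSet_cyl _ _),
        Measure.restrict_apply (measurableSet_cyl _ _)]
      change μ (z.cyl n ∩ x.cyl m) = ν (z.cyl n ∩ x.cyl m)
      rcases (z.cyl n ∩ x.cyl m).eq_empty_or_nonempty with h | ⟨w, hwz, hwx⟩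
      · simp [h]
      · rw [← Path.cyl_eq hwz, ← Path.cyl_eq hwx]
        rcases le_total n m with h | h
        · rw [Set.inter_eq_right.2 (w.cyl_anti h), Path.cyl_eq hwx]
          exact heq m x hx
        · rw [Set.inter_eq_left.2 (w.cyl_anti h)]
          exact heq n w (hmono h (hG m x hx hwx))
    · rw [Measure.restrict_apply_univ, Measure.restrict_apply_univ]
      exact heq m x hx
  have hμ' : μ.restrict (⋃ m, G m) = μ :=
    Measure.restrict_eq_self_of_ae_mem (measure_eq_zero_iff_ae_notMem.1 hμ |>.mono
      fun _ h => not_not.1 h)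
  have hν' : ν.restrict (⋃ m, G m) = ν :=
    Measure.restrict_eq_self_of_ae_mem (measure_eq_zero_iff_ae_notMem.1 hν |>.mono
      fun _ h => not_not.1 h)
  rw [← hμ', ← hν', Measure.restrict_iUnion_congr]
  exact hrestr

/-! ### Invariant measures on cylinders -/

/-- The paths whose cylinder of level `m` has finite measure. -/
def finitePart (ν : Measure B.Path) (m : ℕ) : Set B.Path := {z | ν (z.cyl m) ≠ ∞}

theorem finitePart_mono (ν : Measure B.Path) : Monotone (finitePart ν) :=
  fun _ _ h z hz => ne_top_of_le_ne_top hz (measure_mono (z.cyl_anti h))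

theorem isOpen_of_cyl_subset {m : ℕ} {G : Set B.Path} (hG : ∀ x ∈ G, x.cyl m ⊆ G) : IsOpen G := by
  have : G = ⋃ x ∈ G, x.cyl m :=
    Set.Subset.antisymm (fun x hx => Set.mem_biUnion hx (x.mem_cyl_self m))
      (Set.iUnion₂_subset hG)
  rw [this]
  exact isOpen_biUnion fun x _ => isOpen_cyl x m

theorem cyl_subset_finitePart {ν : Measure B.Path} {m : ℕ} (x : B.Path)
    (hx : x ∈ finitePart ν m) : x.cyl m ⊆ finitePart ν m := fun y hy => by
  change ν (y.cyl m) ≠ ∞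
  rw [Path.cyl_eq hy]
  exact hx

theorem IsErgodicMeasure.cyl_eq (hB : B.IsBratteli) {ν : Measure B.Path}
    (hν : B.IsErgodicMeasure ν) {n : ℕ} {x y : B.Path} (h : x.vtx n = y.vtx n) :
    ν (x.cyl n) = ν (y.cyl n) :=
  hB.isInvariant_iff.1 hν.invariant n x y h

theorem IsErgodicMeasure.exists_cyl (hB : B.IsBratteli) {ν : Measure B.Path}
    (hν : B.IsErgodicMeasure ν) : ∃ (x : B.Path) (n : ℕ), ν (x.cyl n) ≠ 0 ∧ ν (x.cyl n) ≠ ∞ := by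
  obtain ⟨C, hC, hC0, hC1⟩ := hν.exists_clopen
  by_contra! hcon
  refine hC0 (measure_mono_null (t := ⋃₀ {s ∈ B.cylinders | s ⊆ C}) ?_ ?_)
  · intro x hx
    obtain ⟨n, hn⟩ := exists_cyl_subset hC.isOpen hx
    exact ⟨_, ⟨⟨x, n, rfl⟩, hn⟩, x.mem_cyl_self n⟩
  · rw [measure_sUnion_null_iff (hB.countable_cylinders.mono fun _ h => h.1)]
    rintro _ ⟨⟨x, n, rfl⟩, hs⟩
    by_contra h0
    exact ne_top_of_le_ne_top hC1 (measure_mono hs) (hcon x n h0)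

theorem IsErgodicMeasure.compl_null {ν : Measure B.Path} (hν : B.IsErgodicMeasure ν)
    {A : Set B.Path} (hA : MeasurableSet A)
    (hsat : ∀ x y, B.TailEquiv x y → x ∈ A → y ∈ A) (h0 : ν A ≠ 0) : ν Aᶜ = 0 :=
  (hν.ergodic A hA hsat).resolve_left h0

theorem TailEquiv.exists_vtx_eq {x y : B.Path} (h : B.TailEquiv x y) (m : ℕ) :
    ∃ n, m ≤ n ∧ ∀ i, n ≤ i → x.1 i = y.1 i ∧ x.vtx i = y.vtx i := by
  obtain ⟨n, hn⟩ := eventually_atTop.1 h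
  refine ⟨max m n, le_max_left _ _, fun i hi => ?_⟩
  have := hn i ((le_max_right _ _).trans hi)
  exact ⟨this, by rw [Path.vtx, Path.vtx, this]⟩

/-- Cylinders of finite measure cover almost everything: their union is an open, tail saturated
set. -/
theorem IsErgodicMeasure.finitePart_compl (hB : B.IsBratteli) {ν : Measure B.Path}
    (hν : B.IsErgodicMeasure ν) : ν (⋃ m, finitePart ν m)ᶜ = 0 := by
  obtain ⟨x, n, h0, h1⟩ := hν.exists_cyl hB
  refine hν.compl_null ?_ ?_ ?_
  · exact MeasurableSet.iUnion fun m => (isOpen_of_cyl_subset cyl_subset_finitePart).measurableSet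
  · intro y z hyz hy
    obtain ⟨m, hm⟩ := Set.mem_iUnion.1 hy
    obtain ⟨i, hmi, hi⟩ := hyz.exists_vtx_eq m
    refine Set.mem_iUnion.2 ⟨i, ?_⟩
    change ν (z.cyl i) ≠ ∞
    rw [← hν.cyl_eq hB (hi i le_rfl).2]
    exact finitePart_mono ν hmi hm
  · refine fun h => h0 (measure_mono_null ?_ h)
    exact (cyl_subset_finitePart x h1).trans (Set.subset_iUnion _ n)

/-- Invariance of a measure under the exchange of initial segments, for all Borel sets that depend
only on the edges from level `n` on. -/
theorem IsBratteli.measure_inter_cyl_eq (hB : B.IsBratteli) {ν : Measure B.Path}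
    (hinv : ∀ (n : ℕ) (x y : B.Path), x.vtx n = y.vtx n → ν (x.cyl n) = ν (y.cyl n))
    (hfin : ν (⋃ m, finitePart ν m)ᶜ = 0) {n : ℕ} {x y : B.Path} (h : x.vtx n = y.vtx n)
    {A : Set B.Path} (hA : MeasurableSet A)
    (htail : ∀ z w : B.Path, (∀ i, n ≤ i → z.1 i = w.1 i) → z ∈ A → w ∈ A) :
    ν (A ∩ x.cyl n) = ν (A ∩ y.cyl n) := by
  have hS := hB.measurable_splice n y
  have hvtx : ∀ w ∈ x.cyl n, y.vtx n = w.vtx n := fun w hw => by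
    rw [hB.vtx_of_mem_cyl hw le_rfl, h]
  let G : ℕ → Set B.Path := fun m => {z | n ≤ m ∧ z ∈ finitePart ν m}
  have hGcyl : ∀ m, ∀ z ∈ G m, z.cyl m ⊆ G m :=
    fun m z hz w hw => ⟨hz.1, cyl_subset_finitePart z hz.2 hw⟩
  have hGmeas : MeasurableSet (⋃ m, G m)ᶜ :=
    (MeasurableSet.iUnion fun m => (isOpen_of_cyl_subset (hGcyl m)).measurableSet).compl
  have hGnull : ν (⋃ m, G m)ᶜ = 0 := by
    refine measure_mono_null (Set.compl_subset_compl.2 (Set.iUnion_subset fun m z hz => ?_)) hfin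
    exact Set.mem_iUnion.2 ⟨max n m, le_max_left _ _, finitePart_mono ν (le_max_right _ _) hz⟩
  have hval : ∀ m, ∀ z ∈ G m, (ν.restrict (x.cyl n)).map (Path.splice n y) (z.cyl m) =
      ν.restrict (y.cyl n) (z.cyl m) ∧ ν.restrict (y.cyl n) (z.cyl m) ≠ ∞ := by
    intro m z ⟨hnm, hz⟩
    rw [Measure.map_apply hS (measurableSet_cyl _ _), Measure.restrict_apply
      (hS (measurableSet_cyl _ _)), Measure.restrict_apply (measurableSet_cyl _ _)]
    refine ⟨?_, ne_top_of_le_ne_top hz (measure_mono Set.inter_subset_left)⟩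
    by_cases hzy : z ∈ y.cyl n
    · rw [Set.inter_comm, hB.cyl_inter_preimage_splice h hzy hnm, Set.inter_eq_left.2
        ((z.cyl_anti hnm).trans (Path.cyl_eq hzy).le)]
      exact hinv _ _ _ (Path.vtx_splice_ge _ _ _ hnm)
    · have h1 : Path.splice n y ⁻¹' z.cyl m ∩ x.cyl n = ∅ := by
        refine Set.eq_empty_of_forall_notMem fun w hw => hzy ?_
        have h2 := Path.splice_mem_cyl (hvtx w hw.2)
        have h3 := z.cyl_anti hnm hw.1
        rw [← Path.cyl_eq h2, Path.cyl_eq h3]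
        exact z.mem_cyl_self n
      have h2 : z.cyl m ∩ y.cyl n = ∅ := by
        refine Set.eq_empty_of_forall_notMem fun w hw => hzy ?_
        rw [← Path.cyl_eq hw.2, Path.cyl_eq (z.cyl_anti hnm hw.1)]
        exact z.mem_cyl_self n
      rw [h1, h2]
  -- the exchange of initial segments carries `ν` on `x.cyl n` to `ν` on `y.cyl n`
  have hmap : (ν.restrict (x.cyl n)).map (Path.splice n y) = ν.restrict (y.cyl n) := by
    refine hB.measure_ext (G := G) ?_ hGcyl (fun m z hz => ?_) (fun m z hz => (hval m z hz).1) ?_ ?_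
    · exact fun i j hij z hz => ⟨hz.1.trans hij, finitePart_mono ν hij hz.2⟩
    · rw [(hval m z hz).1]
      exact (hval m z hz).2
    · rw [Measure.map_apply hS hGmeas, Measure.restrict_apply (hS hGmeas)]
      refine measure_mono_null ?_ hGnull
      rintro w ⟨hw, hwx⟩ hw'
      obtain ⟨m, hnm, hm⟩ := Set.mem_iUnion.1 hw'
      refine hw (Set.mem_iUnion.2 ⟨m, hnm, ?_⟩)
      change ν ((Path.splice n y w).cyl m) ≠ ∞
      rw [hinv _ _ _ (Path.vtx_splice_ge n y w hnm)]
      exact hm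
    · exact Measure.absolutelyContinuous_of_le Measure.restrict_le_self hGnull
  have h1 := congrArg (fun μ => μ A) hmap
  simp only [Measure.map_apply hS hA, Measure.restrict_apply (hS hA), Measure.restrict_apply hA]
    at h1
  rw [← h1]
  congr 1
  ext w
  refine and_congr_left fun _ => ⟨htail _ _ fun i hi => ?_, htail _ _ fun i hi => ?_⟩
  · exact (Path.splice_apply_ge n y w hi).symm
  · exact Path.splice_apply_ge n y w hi

theorem IsErgodicMeasure.inter_cyl_eq (hB : B.IsBratteli) {ν : Measure B.Path}
    (hν : B.IsErgodicMeasure ν) {n : ℕ} {x y : B.Path} (h : x.vtx n = y.vtx n)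
    {A : Set B.Path} (hA : MeasurableSet A)
    (htail : ∀ z w : B.Path, (∀ i, n ≤ i → z.1 i = w.1 i) → z ∈ A → w ∈ A) :
    ν (A ∩ x.cyl n) = ν (A ∩ y.cyl n) :=
  hB.measure_inter_cyl_eq (hB.isInvariant_iff.1 hν.invariant) (hν.finitePart_compl hB) h hA htail

/-! ### Counting finite paths -/

/-- The number of finite paths from the vertex of `y` at level `l` to the vertex `v` of level `n`,
counted as initial segments of length `n` that continue the initial segment of `y`. -/
noncomputable def Path.numPaths (y : B.Path) (l n : ℕ) (v : L) : ℕ :=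
  (Path.pre n '' (y.cyl l ∩ B.through n v)).ncard

theorem IsBratteli.numPaths_eq (hB : B.IsBratteli) {y z : B.Path} {l n : ℕ} (hln : l ≤ n)
    (h : y.vtx l = z.vtx l) (v : L) : y.numPaths l n v = z.numPaths l n v := by
  have := hB.finite_pre n
  suffices key : ∀ y z : B.Path, y.vtx l = z.vtx l → y.numPaths l n v ≤ z.numPaths l n v from
    le_antisymm (key y z h) (key z y h.symm)
  intro y z h
  refine Set.ncard_le_ncard_of_injOn
    (fun c (i : Fin n) => if (i : ℕ) < l then z.1 i else c i) ?_ ?_ (Set.toFinite _)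
  · rintro _ ⟨w, ⟨hw, hwv⟩, rfl⟩
    have hzw : z.vtx l = w.vtx l := by rw [hB.vtx_of_mem_cyl hw le_rfl, h]
    refine ⟨Path.splice l z w, ⟨Path.splice_mem_cyl hzw, ?_⟩, ?_⟩
    · exact (Path.vtx_splice_ge l z w hln).trans hwv
    · funext i
      by_cases hi : (i : ℕ) < l
      · simp [Path.pre, hi, Path.splice_apply_lt hzw hi]
      · simp [Path.pre, hi, Path.splice_apply_ge l z w (not_lt.1 hi)]
  · rintro _ ⟨w, ⟨hw, -⟩, rfl⟩ _ ⟨w', ⟨hw', -⟩, rfl⟩ heq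
    funext i
    by_cases hi : (i : ℕ) < l
    · exact (hw i hi).trans (hw' i hi).symm
    · have := congrFun heq i
      simpa [hi] using this

theorem IsBratteli.measure_cyl_inter_through (hB : B.IsBratteli) {ρ : Measure B.Path} {n l : ℕ}
    (hln : l ≤ n) {v : L} {p : ℝ≥0∞} (hp : ∀ z : B.Path, z.vtx n = v → ρ (z.cyl n) = p)
    (y : B.Path) : ρ (y.cyl l ∩ B.through n v) = y.numPaths l n v * p := by
  have := hB.finite_pre n
  set P := Path.pre n '' (y.cyl l ∩ B.through n v) with hP
  have hset : y.cyl l ∩ B.through n v = Path.pre n ⁻¹' (P.toFinite.toFinset : Set _) := by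
    ext w
    simp only [Set.Finite.coe_toFinset, Set.mem_preimage]
    refine ⟨fun h => ⟨w, h, rfl⟩, ?_⟩
    rintro ⟨z, ⟨hz, hzv⟩, hzw⟩
    have hw : w ∈ z.cyl n := by
      rw [z.cyl_eq_preimage n, hzw]
      rfl
    exact ⟨(Path.cyl_eq hz).le (z.cyl_anti hln hw), (hB.vtx_of_mem_cyl hw le_rfl).trans hzv⟩
  have hfiber : ∀ c ∈ P, ∃ z : B.Path, Path.pre n ⁻¹' {c} = z.cyl n ∧ z.vtx n = v := by
    rintro _ ⟨z, ⟨-, hzv⟩, rfl⟩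
    exact ⟨z, (z.cyl_eq_preimage n).symm, hzv⟩
  have hsum := sum_measure_preimage_singleton (μ := ρ) (f := Path.pre n) P.toFinite.toFinset
    (fun c hc => by
      obtain ⟨z, hz, -⟩ := hfiber c ((Set.Finite.mem_toFinset _).1 hc)
      rw [hz]
      exact measurableSet_cyl z n)
  rw [hset, ← hsum, Finset.sum_congr rfl (g := fun _ => p), Finset.sum_const, nsmul_eq_mul,
    Path.numPaths, Set.ncard_eq_toFinset_card _ P.toFinite]
  intro c hc
  obtain ⟨z, hz, hzv⟩ := hfiber c ((Set.Finite.mem_toFinset _).1 hc)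
  rw [hz]
  exact hp z hzv

/-- The proportion in which an invariant measure distributes the paths through a vertex among
cylinders of lower levels is determined by the diagram. -/
theorem IsBratteli.measure_cross_mul (hB : B.IsBratteli) {μ ν : Measure B.Path}
    (hμ : ∀ (n : ℕ) (x y : B.Path), x.vtx n = y.vtx n → μ (x.cyl n) = μ (y.cyl n))
    (hν : ∀ (n : ℕ) (x y : B.Path), x.vtx n = y.vtx n → ν (x.cyl n) = ν (y.cyl n))
    {f f' g g' : B.Path} {l k n : ℕ} (hl : l ≤ n) (hk : k ≤ n) (hf : f.vtx l = f'.vtx l)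
    (hg : g.vtx k = g'.vtx k) (v : L) :
    μ (f.cyl l ∩ B.through n v) * ν (g'.cyl k ∩ B.through n v) =
      μ (g.cyl k ∩ B.through n v) * ν (f'.cyl l ∩ B.through n v) := by
  by_cases h : ∃ z : B.Path, z.vtx n = v
  · obtain ⟨z, rfl⟩ := h
    have h1 : ∀ w : B.Path, w.vtx n = z.vtx n → μ (w.cyl n) = μ (z.cyl n) :=
      fun w => hμ n w z
    have h2 : ∀ w : B.Path, w.vtx n = z.vtx n → ν (w.cyl n) = ν (z.cyl n) :=
      fun w => hν n w z
    rw [hB.measure_cyl_inter_through hl h1, hB.measure_cyl_inter_through hk h1,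
      hB.measure_cyl_inter_through hl h2, hB.measure_cyl_inter_through hk h2,
      hB.numPaths_eq hl hf, hB.numPaths_eq hk hg]
    ring
  · have h0 : B.through n v = ∅ := Set.eq_empty_of_forall_notMem fun z hz => h ⟨z, hz⟩
    simp [h0]

/-! ### Asymptotic independence for ergodic measures -/

/-- The σ-algebra of the Borel sets that depend only on the edges from level `n` on. -/
@[reducible]
def tailAlgebra (B : LevelGraph L) (n : ℕ) : MeasurableSpace B.Path where
  MeasurableSet' A := MeasurableSet A ∧
    ∀ x y : B.Path, (∀ i, n ≤ i → x.1 i = y.1 i) → (x ∈ A ↔ y ∈ A)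
  measurableSet_empty := ⟨MeasurableSet.empty, fun _ _ _ => Iff.rfl⟩
  measurableSet_compl _ h := ⟨h.1.compl, fun x y hxy => not_congr (h.2 x y hxy)⟩
  measurableSet_iUnion f h := ⟨MeasurableSet.iUnion fun i => (h i).1, fun x y hxy => by
    simp only [Set.mem_iUnion]
    exact exists_congr fun i => (h i).2 x y hxy⟩

/-- For an ergodic measure, the event of passing through `v` at level `n` is asymptotically
independent of any event inside a cylinder of finite measure, relative to that cylinder. -/
theorem IsErgodicMeasure.tendsto_inter_through {ν : Measure B.Path} (hν : B.IsErgodicMeasure ν)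
    {x : B.Path} {k : ℕ} (hx : ν (x.cyl k) ≠ ∞) {A : Set B.Path} (hA : MeasurableSet A)
    (hAx : A ⊆ x.cyl k) (v : L) :
    Tendsto (fun n => ν.real (A ∩ B.through n v) * ν.real (x.cyl k) -
      ν.real A * ν.real (x.cyl k ∩ B.through n v)) atTop (𝓝 0) := by
  have hfin : IsFiniteMeasure (ν.restrict (x.cyl k)) := ⟨by
    rw [Measure.restrict_apply_univ]
    exact hx.lt_top⟩
  have key := tendsto_measureReal_inter_of_trivial_iInf (ρ := ν.restrict (x.cyl k))
    (𝒯 := B.tailAlgebra) (fun n A h => h.1)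
    (fun i j hij A h => ⟨h.1, fun y z hyz => h.2 y z fun l hl => hyz l (hij.trans hl)⟩)
    (fun S hS => by
      have h1 := hν.ergodic S (hS 0).1 fun y z hyz hy => by
        obtain ⟨n, hn⟩ := eventually_atTop.1 hyz
        exact ((hS n).2 y z hn).1 hy
      exact h1.imp (fun h => Measure.absolutelyContinuous_of_le Measure.restrict_le_self h)
        fun h => Measure.absolutelyContinuous_of_le Measure.restrict_le_self h)
    hA (T := fun n => B.through n v)
    (fun n => ⟨measurableSet_through n v, fun y z hyz => by
      change y.vtx n = v ↔ z.vtx n = v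
      rw [Path.vtx, Path.vtx, hyz n le_rfl]⟩)
  have h1 : ∀ S, MeasurableSet S → (ν.restrict (x.cyl k)).real S = ν.real (S ∩ x.cyl k) :=
    fun S hS => measureReal_restrict_apply hS
  refine key.congr fun n => ?_
  rw [h1 _ (hA.inter (measurableSet_through n v)), h1 _ hA, h1 _ (measurableSet_through n v),
    h1 _ MeasurableSet.univ, Set.univ_inter, Set.inter_right_comm, Set.inter_eq_left.2 hAx,
    Set.inter_comm (x.cyl k)]

/-- If a vertex `v` keeps a definite proportion of a cylinder along a filter, then conditioning on
the passage through `v` has no effect in the limit. -/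
theorem IsErgodicMeasure.tendsto_ratio {ν : Measure B.Path} (hν : B.IsErgodicMeasure ν)
    {x : B.Path} {k : ℕ} (hx : ν (x.cyl k) ≠ ∞) {A : Set B.Path} (hA : MeasurableSet A)
    (hAx : A ⊆ x.cyl k) {v : L} {𝒰 : Filter ℕ} (h𝒰 : 𝒰 ≤ atTop) {δ : ℝ} (hδ : 0 < δ)
    (hv : ∀ᶠ n in 𝒰, δ ≤ ν.real (x.cyl k ∩ B.through n v)) :
    Tendsto (fun n => ν.real (A ∩ B.through n v) / ν.real (x.cyl k ∩ B.through n v)) 𝒰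
      (𝓝 (ν.real A / ν.real (x.cyl k))) := by
  rcases 𝒰.eq_or_neBot with rfl | hne
  · exact tendsto_bot
  have hpos : 0 < ν.real (x.cyl k) := by
    obtain ⟨n, hn⟩ := hv.exists
    exact hδ.trans_le (hn.trans (measureReal_mono Set.inter_subset_left hx))
  have h0 := ((hν.tendsto_inter_through hx hA hAx v).mono_left h𝒰).abs.const_mul
    (1 / (δ * ν.real (x.cyl k)))
  rw [abs_zero, mul_zero] at h0
  rw [tendsto_iff_norm_sub_tendsto_zero]
  refine squeeze_zero' (Eventually.of_forall fun n => norm_nonneg _) ?_ h0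
  filter_upwards [hv] with n hn
  have htn : 0 < ν.real (x.cyl k ∩ B.through n v) := hδ.trans_le hn
  rw [div_sub_div _ _ htn.ne' hpos.ne', Real.norm_eq_abs, abs_div,
    abs_of_pos (mul_pos htn hpos), div_eq_mul_one_div, mul_comm]
  rw [mul_comm (ν.real (x.cyl k ∩ B.through n v)) (ν.real A)]
  refine mul_le_mul_of_nonneg_right ?_ (abs_nonneg _)
  exact one_div_le_one_div_of_le (mul_pos hδ hpos) (mul_le_mul_of_nonneg_right hn hpos.le)

/-! ### Ergodic measures that share a recurrent vertex are proportional -/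

theorem IsBratteli.exists_mem_cyl_ne_zero (hB : B.IsBratteli) {ν : Measure B.Path} {S : Set B.Path}
    (h : ν S ≠ 0) (n : ℕ) : ∃ z ∈ S, ν (z.cyl n) ≠ 0 := by
  by_contra! hcon
  refine h (measure_mono_null (t := ⋃₀ ((fun z : B.Path => z.cyl n) '' S)) ?_ ?_)
  · exact fun z hz => ⟨_, ⟨z, hz, rfl⟩, z.mem_cyl_self n⟩
  · rw [measure_sUnion_null_iff
      ((hB.finite_range_cyl n).subset (Set.image_subset_range _ _)).countable]
    rintro _ ⟨z, hz, rfl⟩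
    exact hcon z hz

/-- Two ergodic measures are proportional if some vertex label `v` keeps, for both of them, a
definite proportion of a cylinder of finite measure along a common filter of levels.  In that case
the weights of both measures are limits of the same ratios of numbers of finite paths. -/
theorem IsErgodicMeasure.exists_smul_eq (hB : B.IsBratteli) {ν ν' : Measure B.Path}
    (hν : B.IsErgodicMeasure ν) (hν' : B.IsErgodicMeasure ν') {𝒰 : Filter ℕ} [𝒰.NeBot]
    (h𝒰 : 𝒰 ≤ atTop) {x x' : B.Path} {k k' : ℕ} (hx : ν (x.cyl k) ≠ ∞)
    (hx' : ν' (x'.cyl k') ≠ ∞) {v : L} {δ δ' : ℝ} (hδ : 0 < δ) (hδ' : 0 < δ')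
    (hv : ∀ᶠ n in 𝒰, δ ≤ ν.real (x.cyl k ∩ B.through n v))
    (hv' : ∀ᶠ n in 𝒰, δ' ≤ ν'.real (x'.cyl k' ∩ B.through n v)) :
    ∃ c : ℝ≥0, c ≠ 0 ∧ ν' = c • ν := by
  have hinv := hB.isInvariant_iff.1 hν.invariant
  have hinv' := hB.isInvariant_iff.1 hν'.invariant
  -- cylinders `z.cyl n` and `z'.cyl n` inside the given ones that end at the same vertex
  have hge : ∀ j, ∀ᶠ m in 𝒰, j ≤ m := fun j => h𝒰 (eventually_ge_atTop j)
  obtain ⟨n, ⟨hvn, hvn'⟩, hkn, hkn'⟩ := ((hv.and hv').and ((hge k).and (hge k'))).exists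
  have hne : ∀ {μ : Measure B.Path} {S : Set B.Path} {ε : ℝ}, 0 < ε → ε ≤ μ.real S → μ S ≠ 0 := by
    intro μ S ε hε h h0
    rw [measureReal_def, h0, ENNReal.toReal_zero] at h
    exact hε.not_ge h
  obtain ⟨z, ⟨hzx, hzv⟩, hz0⟩ := hB.exists_mem_cyl_ne_zero (hne hδ hvn) n
  obtain ⟨z', ⟨hzx', hzv'⟩, hz0'⟩ := hB.exists_mem_cyl_ne_zero (hne hδ' hvn') n
  have hsub : z.cyl n ⊆ x.cyl k := (z.cyl_anti hkn).trans (Path.cyl_eq hzx).le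
  have hsub' : z'.cyl n ⊆ x'.cyl k' := (z'.cyl_anti hkn').trans (Path.cyl_eq hzx').le
  have hzt : ν (z.cyl n) ≠ ∞ := ne_top_of_le_ne_top hx (measure_mono hsub)
  have hzt' : ν' (z'.cyl n) ≠ ∞ := ne_top_of_le_ne_top hx' (measure_mono hsub')
  have hzz : z'.vtx n = z.vtx n := hzv'.trans hzv.symm
  have hpos : 0 < ν.real (z.cyl n) := ENNReal.toReal_pos hz0 hzt
  have hpos' : 0 < ν'.real (z'.cyl n) := ENNReal.toReal_pos hz0' hzt'
  -- the limit of the ratios, for one measure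
  have hlim : ∀ {μ : Measure B.Path} {w g f : B.Path} {i l : ℕ} {ε : ℝ}, B.IsErgodicMeasure μ →
      μ (w.cyl i) ≠ ∞ → 0 < ε → (∀ᶠ m in 𝒰, ε ≤ μ.real (w.cyl i ∩ B.through m v)) →
      g.cyl n ⊆ w.cyl i → 0 < μ.real (g.cyl n) → f.cyl l ⊆ g.cyl n →
      Tendsto (fun m => μ.real (f.cyl l ∩ B.through m v) / μ.real (g.cyl n ∩ B.through m v)) 𝒰
        (𝓝 (μ.real (f.cyl l) / μ.real (g.cyl n))) := by
    intro μ w g f i l ε hμ hw hε hev hgw hg hfg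
    have h1 := hμ.tendsto_ratio hw (measurableSet_cyl f l) (hfg.trans hgw) h𝒰 hε hev
    have h2 := hμ.tendsto_ratio hw (measurableSet_cyl g n) hgw h𝒰 hε hev
    have hwpos : 0 < μ.real (w.cyl i) := hg.trans_le (measureReal_mono hgw hw)
    have h3 := h1.div h2 (div_pos hg hwpos).ne'
    rw [div_div_div_cancel_right₀ hwpos.ne'] at h3
    refine h3.congr' ?_
    filter_upwards [hev] with m hm
    rw [Pi.div_apply, div_div_div_cancel_right₀ (hε.trans_le hm).ne']
  have hvtx : ∀ y ∈ z.cyl n, z'.vtx n = y.vtx n := fun y hy => by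
    rw [hB.vtx_of_mem_cyl hy le_rfl, hzz]
  -- the factor is read off from these two cylinders, and it then works for all longer ones
  set c : ℝ := ν'.real (z'.cyl n) / ν.real (z.cyl n) with hc
  have hcpos : 0 < c := div_pos hpos' hpos
  have key : ∀ l, n ≤ l → ∀ y ∈ z.cyl n, ν.real (y.cyl l) * c =
      ν'.real ((Path.splice n z' y).cyl l) := by
    intro l hnl y hy
    set y' := Path.splice n z' y with hy'
    have hyz : y.cyl l ⊆ z.cyl n := (y.cyl_anti hnl).trans (Path.cyl_eq hy).le
    have hyz' : y'.cyl l ⊆ z'.cyl n := (y'.cyl_anti hnl).trans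
      (Path.cyl_eq (Path.splice_mem_cyl (hvtx y hy))).le
    have h1 := hlim hν hx hδ hv hsub hpos hyz
    have h2 := hlim hν' hx' hδ' hv' hsub' hpos' hyz'
    have hpos1 : ∀ᶠ m in 𝒰, 0 < ν.real (z.cyl n ∩ B.through m v) := by
      have h3 := hν.tendsto_ratio hx (measurableSet_cyl z n) hsub h𝒰 hδ hv
      have h4 := div_pos hpos (hpos.trans_le (measureReal_mono hsub hx))
      filter_upwards [h3.eventually (lt_mem_nhds h4)] with m hm
      refine measureReal_nonneg.lt_of_ne' fun h => ?_
      rw [h, zero_div] at hm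
      exact lt_irrefl _ hm
    have hpos2 : ∀ᶠ m in 𝒰, 0 < ν'.real (z'.cyl n ∩ B.through m v) := by
      have h3 := hν'.tendsto_ratio hx' (measurableSet_cyl z' n) hsub' h𝒰 hδ' hv'
      have h4 := div_pos hpos' (hpos'.trans_le (measureReal_mono hsub' hx'))
      filter_upwards [h3.eventually (lt_mem_nhds h4)] with m hm
      refine measureReal_nonneg.lt_of_ne' fun h => ?_
      rw [h, zero_div] at hm
      exact lt_irrefl _ hm
    have h3 := tendsto_nhds_unique_of_eventuallyEq h1 h2 (by
      filter_upwards [hpos1, hpos2, hge l] with m hm1 hm2 hlm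
      rw [div_eq_div_iff hm1.ne' hm2.ne']
      have h4 := congrArg ENNReal.toReal (hB.measure_cross_mul hinv hinv' hlm (hnl.trans hlm)
        (f := y) (f' := y') (g := z) (g' := z') (Path.vtx_splice_ge n z' y hnl).symm hzz.symm v)
      rw [ENNReal.toReal_mul, ENNReal.toReal_mul] at h4
      rw [measureReal_def, measureReal_def, measureReal_def, measureReal_def, h4, mul_comm])
    rw [div_eq_div_iff hpos.ne' hpos'.ne'] at h3
    rw [hc, ← mul_div_assoc, h3, mul_div_assoc, div_self hpos.ne', mul_one]
  have hcC : ((c.toNNReal : ℝ≥0) : ℝ) = c := Real.coe_toNNReal c hcpos.le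
  refine ⟨c.toNNReal, (Real.toNNReal_pos.2 hcpos).ne', ?_⟩
  -- `G m` consists of the paths whose vertex at level `m` can be reached from the vertex where
  -- `z.cyl n` ends.  The union is saturated and hence co-null for both measures.
  let G : ℕ → Set B.Path := fun m => {w | n ≤ m ∧ ∃ y ∈ z.cyl n, y.vtx m = w.vtx m}
  have hGcyl : ∀ m, ∀ w ∈ G m, w.cyl m ⊆ G m := by
    rintro m w ⟨hnm, y, hy, hyw⟩ u hu
    exact ⟨hnm, y, hy, hyw.trans (hB.vtx_of_mem_cyl hu le_rfl).symm⟩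
  have hGmono : Monotone G := by
    refine monotone_nat_of_le_succ ?_
    rintro m w ⟨hnm, y, hy, hyw⟩
    refine ⟨hnm.trans m.le_succ, Path.splice m y w, ?_, Path.vtx_splice_ge m y w m.le_succ⟩
    rw [← Path.cyl_eq hy]
    exact y.cyl_anti hnm (Path.splice_mem_cyl hyw)
  have hGmeas : MeasurableSet (⋃ m, G m) :=
    MeasurableSet.iUnion fun m => (isOpen_of_cyl_subset (hGcyl m)).measurableSet
  have hGsat : ∀ w u, B.TailEquiv w u → w ∈ ⋃ m, G m → u ∈ ⋃ m, G m := by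
    intro w u hwu hw
    obtain ⟨m, hm⟩ := Set.mem_iUnion.1 hw
    obtain ⟨i, hmi, hi⟩ := hwu.exists_vtx_eq m
    obtain ⟨hni, y, hy, hyw⟩ := hGmono hmi hm
    exact Set.mem_iUnion.2 ⟨i, hni, y, hy, hyw.trans (hi i le_rfl).2⟩
  have hGz : z.cyl n ⊆ ⋃ m, G m :=
    fun w hw => Set.mem_iUnion.2 ⟨n, le_rfl, w, hw, rfl⟩
  have hGz' : z'.cyl n ⊆ ⋃ m, G m :=
    fun w hw => Set.mem_iUnion.2 ⟨n, le_rfl, z, z.mem_cyl_self n,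
      hzz.symm.trans (hB.vtx_of_mem_cyl hw le_rfl).symm⟩
  have hval : ∀ m, ∀ w ∈ G m, ν' (w.cyl m) ≠ ∞ ∧
      ν' (w.cyl m) = (c.toNNReal • ν) (w.cyl m) := by
    rintro m w ⟨hnm, y, hy, hyw⟩
    have hyt : ν (y.cyl m) ≠ ∞ := ne_top_of_le_ne_top hzt
      (measure_mono ((y.cyl_anti hnm).trans (Path.cyl_eq hy).le))
    have h1 : ν' (w.cyl m) = ν' ((Path.splice n z' y).cyl m) :=
      hinv' _ _ _ (hyw.symm.trans (Path.vtx_splice_ge n z' y hnm).symm)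
    have h2 : ν' (w.cyl m) ≠ ∞ := by
      rw [h1]
      refine ne_top_of_le_ne_top hzt' (measure_mono ?_)
      exact (Path.cyl_anti _ hnm).trans (Path.cyl_eq (Path.splice_mem_cyl (hvtx y hy))).le
    refine ⟨h2, ?_⟩
    rw [Measure.smul_apply, ← hinv m y w hyw, ENNReal.smul_def, smul_eq_mul,
      ← ENNReal.toReal_eq_toReal_iff' h2 (ENNReal.mul_ne_top ENNReal.coe_ne_top hyt),
      ENNReal.toReal_mul, h1, ENNReal.coe_toReal, hcC]
    exact (key m hnm y hy).symm.trans (mul_comm _ _)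
  refine hB.measure_ext hGmono hGcyl (fun m w hw => (hval m w hw).1)
    (fun m w hw => (hval m w hw).2) ?_ ?_
  · exact hν'.compl_null hGmeas hGsat fun h => hz0' (measure_mono_null hGz' h)
  · rw [Measure.smul_apply, hν.compl_null hGmeas hGsat fun h => hz0 (measure_mono_null hGz h),
      smul_zero]

/-- A finite measure keeps a definite proportion of a non-null set on the paths through some
vertex, along any ultrafilter of levels. -/
theorem exists_through_ge [Finite L] {ν : Measure B.Path} {S : Set B.Path}
    (h0 : ν S ≠ 0) (h1 : ν S ≠ ∞) (𝒰 : Ultrafilter ℕ) :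
    ∃ v : L, ∃ δ : ℝ, 0 < δ ∧ ∀ᶠ n in 𝒰, δ ≤ ν.real (S ∩ B.through n v) := by
  have : Fintype L := Fintype.ofFinite L
  have hpos : 0 < ν.real S := ENNReal.toReal_pos h0 h1
  have hcard : 0 < Fintype.card L := by
    obtain ⟨x, -⟩ := nonempty_of_measure_ne_zero h0
    exact Fintype.card_pos_iff.2 ⟨x.vtx 0⟩
  by_contra! hcon
  have h2 : ∀ v : L, ∀ᶠ n in 𝒰, ν.real (S ∩ B.through n v) < ν.real S / Fintype.card L :=
    fun v => hcon v _ (div_pos hpos (Nat.cast_pos.2 hcard))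
  obtain ⟨n, hn⟩ := (eventually_all.2 h2).exists
  have h3 : ν.real S ≤ ∑ v, ν.real (S ∩ B.through n v) := by
    have h4 : S = ⋃ v ∈ Finset.univ, S ∩ B.through n v := by
      ext x
      simp [through]
    conv_lhs => rw [h4]
    exact measureReal_biUnion_finset_le _ _
  have : Nonempty L := Fintype.card_pos_iff.1 hcard
  have h5 := h3.trans_lt (Finset.sum_lt_sum_of_nonempty Finset.univ_nonempty fun v _ => hn v)
  rw [Finset.sum_const, Finset.card_univ, nsmul_eq_mul, mul_div_cancel₀] at h5
  · exact lt_irrefl _ h5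
  · exact Nat.cast_ne_zero.2 hcard.ne'

/-- Up to scalar multiples, the ergodic measures inject into the vertex labels. -/
theorem IsBratteli.exists_finset_ergodic {d : ℕ} {B : LevelGraph (Fin d)} (hB : B.IsBratteli) :
    ∃ S : Finset (Measure B.Path), S.card ≤ d ∧
      ∀ ν : Measure B.Path, B.IsErgodicMeasure ν → ∃ ρ ∈ S, ∃ c : ℝ≥0, c ≠ 0 ∧ ν = c • ρ := by
  classical
  let P : Measure B.Path → Fin d → Prop := fun ν v => B.IsErgodicMeasure ν ∧
    ∃ (x : B.Path) (k : ℕ), ν (x.cyl k) ≠ ∞ ∧ ∃ δ : ℝ, 0 < δ ∧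
      ∀ᶠ n in hyperfilter ℕ, δ ≤ ν.real (x.cyl k ∩ B.through n v)
  have hP : ∀ ν ν' v, P ν v → P ν' v → ∃ c : ℝ≥0, c ≠ 0 ∧ ν' = c • ν := by
    rintro ν ν' v ⟨hν, x, k, hx, δ, hδ, hv⟩ ⟨hν', x', k', hx', δ', hδ', hv'⟩
    exact hν.exists_smul_eq hB hν' Nat.hyperfilter_le_atTop hx hx' hδ hδ' hv hv'
  refine ⟨Finset.univ.image fun v : Fin d => if h : ∃ ν, P ν v then h.choose else 0, ?_, ?_⟩
  · exact Finset.card_image_le.trans (by simp)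
  · intro ν hν
    obtain ⟨x, k, h0, h1⟩ := hν.exists_cyl hB
    obtain ⟨v, δ, hδ, hv⟩ := exists_through_ge h0 h1 (hyperfilter ℕ)
    have hνv : P ν v := ⟨hν, x, k, h1, δ, hδ, hv⟩
    have hex : ∃ ν, P ν v := ⟨ν, hνv⟩
    refine ⟨hex.choose, Finset.mem_image.2 ⟨v, Finset.mem_univ _, dif_pos hex⟩, ?_⟩
    exact hP _ _ v hex.choose_spec hνv

section Subdiagrams

variable {W : Set L}

/-! ### Path spaces of vertical subdiagrams -/

/-- The paths that visit only vertices of `W` from level `n` on. -/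
def staysIn (B : LevelGraph L) (W : Set L) (n : ℕ) : Set B.Path := {x | ∀ i, n ≤ i → x.vtx i ∈ W}

theorem measurableSet_staysIn (W : Set L) (n : ℕ) : MeasurableSet (B.staysIn W n) := by
  have : B.staysIn W n = ⋂ i, {x : B.Path | n ≤ i → x.vtx i ∈ W} := by
    ext x
    simp [staysIn]
  rw [this]
  refine MeasurableSet.iInter fun i => ?_
  by_cases h : n ≤ i
  · simpa [h] using measurableSet_vtx i W
  · simp [h]

theorem staysIn_tail {n : ℕ} {x y : B.Path} (h : ∀ i, n ≤ i → x.1 i = y.1 i)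
    (hx : x ∈ B.staysIn W n) : y ∈ B.staysIn W n := fun i hi => by
  have := hx i hi
  rwa [Path.vtx, h i hi] at this

theorem staysIn_mono (W : Set L) : Monotone (B.staysIn W) :=
  fun _ _ h _ hx i hi => hx i (h.trans hi)

theorem mem_iUnion_staysIn {x : B.Path} :
    x ∈ ⋃ n, B.staysIn W (n + 1) ↔ ∀ᶠ n in atTop, x.vtx n ∈ W := by
  rw [Set.mem_iUnion, eventually_atTop]
  exact ⟨fun ⟨n, hn⟩ => ⟨n + 1, hn⟩, fun ⟨n, hn⟩ => ⟨n, fun i hi => hn i (n.le_succ.trans hi)⟩⟩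

theorem vtx_verticalIncl (y : (B.vertical W).Path) (n : ℕ) :
    (B.verticalIncl W y).vtx n = y.vtx n := rfl

theorem mem_vertical_level_iff {n : ℕ} (hn : 1 ≤ n) {v : L} :
    v ∈ (fun n : ℕ => if n = 0 then Set.univ else W) n ↔ v ∈ W := by
  have h : n ≠ 0 := by omega
  simp only [if_neg h]

theorem vtx_vertical_mem (y : (B.vertical W).Path) {n : ℕ} (hn : 1 ≤ n) : y.vtx n ∈ W :=
  (mem_vertical_level_iff hn).1 (y.1 n).2.1

theorem verticalIncl_injective (B : LevelGraph L) (W : Set L) :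
    Function.Injective (B.verticalIncl W) := fun _ _ h =>
  Path.ext fun i => Subtype.ext (congrFun (congrArg Subtype.val h) i)

theorem range_verticalIncl (B : LevelGraph L) (W : Set L) :
    Set.range (B.verticalIncl W) = B.staysIn W 1 := by
  ext z
  constructor
  · rintro ⟨y, rfl⟩ i hi
    exact vtx_vertical_mem y hi
  · intro hz
    refine ⟨⟨fun n => ⟨z.1 n, ?_, ?_⟩, z.2⟩, rfl⟩
    · rcases Nat.eq_zero_or_pos n with rfl | hn
      · exact Set.mem_univ _
      · exact (mem_vertical_level_iff hn).2 (hz n hn)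
    · refine (mem_vertical_level_iff n.succ_pos).2 ?_
      rw [z.rng_eq_vtx]
      exact hz (n + 1) n.succ_pos

theorem tailEquiv_verticalIncl {x y : (B.vertical W).Path} :
    B.TailEquiv (B.verticalIncl W x) (B.verticalIncl W y) ↔ (B.vertical W).TailEquiv x y :=
  eventually_congr (Eventually.of_forall fun _ => Subtype.ext_iff.symm)

theorem verticalIncl_preimage_cyl (y : (B.vertical W).Path) (n : ℕ) :
    B.verticalIncl W ⁻¹' (B.verticalIncl W y).cyl n = y.cyl n :=
  Set.ext fun _ => forall₂_congr fun _ _ => Subtype.ext_iff.symm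

theorem verticalIncl_image_cyl (hB : B.IsBratteli) (y : (B.vertical W).Path) {n : ℕ} (hn : 1 ≤ n) :
    B.verticalIncl W '' y.cyl n = B.staysIn W n ∩ (B.verticalIncl W y).cyl n := by
  rw [← verticalIncl_preimage_cyl, Set.image_preimage_eq_inter_range, range_verticalIncl,
    Set.inter_comm]
  ext z
  refine and_congr_left fun hz => ⟨fun h => staysIn_mono W hn h, fun h i hi => ?_⟩
  rcases le_total n i with hni | hin
  · exact h i hni
  · rw [hB.vtx_of_mem_cyl hz hin]
    exact vtx_vertical_mem y hi

theorem measurable_verticalIncl (hB : B.IsBratteli) : Measurable (B.verticalIncl W) :=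
  hB.measurable_of_coord fun n e => measurableSet_coord (B := B.vertical W) n {f | f.1 = e}

theorem measurableEmbedding_verticalIncl (hB : B.IsBratteli) (hD : (B.vertical W).IsBratteli) :
    MeasurableEmbedding (B.verticalIncl W) := by
  refine MeasurableEmbedding.iff_comap_eq.2 ⟨verticalIncl_injective B W, ?_, ?_⟩
  · refine le_antisymm (measurable_verticalIncl hB).comap_le ?_
    refine hD.borel_eq_generateFrom.le.trans (MeasurableSpace.generateFrom_le ?_)
    rintro _ ⟨y, n, rfl⟩
    exact ⟨_, measurableSet_cyl (B.verticalIncl W y) n, verticalIncl_preimage_cyl y n⟩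
  · rw [range_verticalIncl]
    exact measurableSet_staysIn W 1

theorem saturation_subset (B : LevelGraph L) (W : Set L) :
    B.saturation W ⊆ {x | ∀ᶠ n in atTop, x.vtx n ∈ W} := by
  rintro x ⟨y, hy⟩
  filter_upwards [hy, eventually_ge_atTop 1] with n hn hn1
  rw [Path.vtx, hn]
  exact vtx_vertical_mem y hn1

theorem splice_mem_range_verticalIncl {y : (B.vertical W).Path} {n : ℕ} {x : B.Path}
    (h : y.vtx n = x.vtx n) (hx : x ∈ B.staysIn W n) :
    Path.splice n (B.verticalIncl W y) x ∈ Set.range (B.verticalIncl W) := by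
  rw [range_verticalIncl]
  intro i hi
  rcases le_total n i with hni | hin
  · rw [Path.vtx_splice_ge _ _ _ hni]
    exact hx i hni
  · rw [Path.vtx_splice_le h hin]
    exact vtx_vertical_mem y hi

theorem tailEquiv_splice (n : ℕ) (y x : B.Path) : B.TailEquiv x (Path.splice n y x) := by
  filter_upwards [eventually_ge_atTop n] with i hi
  exact (Path.splice_apply_ge n y x hi).symm

theorem TailEquiv.symm {x y : B.Path} (h : B.TailEquiv x y) : B.TailEquiv y x :=
  h.mono fun _ h => h.symm

theorem TailEquiv.trans {x y z : B.Path} (h : B.TailEquiv x y) (h' : B.TailEquiv y z) :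
    B.TailEquiv x z := by
  filter_upwards [h, h'] with n h1 h2 using h1.trans h2

theorem exists_vertical_vtx_eq (hD : (B.vertical W).IsBratteli) {n : ℕ} (hn : 1 ≤ n) {x : B.Path}
    (hx : x.vtx n ∈ W) : ∃ y : (B.vertical W).Path, y.vtx n = x.vtx n :=
  hD.exists_vtx_eq n ⟨x.vtx_mem n, (mem_vertical_level_iff hn).2 hx⟩

theorem saturation_eq (hD : (B.vertical W).IsBratteli) :
    B.saturation W = {x | ∀ᶠ n in atTop, x.vtx n ∈ W} := by
  refine (saturation_subset B W).antisymm fun x hx => ?_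
  obtain ⟨n, hn⟩ := Set.mem_iUnion.1 (mem_iUnion_staysIn.2 hx)
  obtain ⟨y, hy⟩ := exists_vertical_vtx_eq hD n.succ_pos (hn (n + 1) le_rfl)
  obtain ⟨z, hz⟩ := splice_mem_range_verticalIncl hy hn
  exact ⟨z, hz ▸ tailEquiv_splice _ _ _⟩

/-! ### Restriction of ergodic measures to vertical subdiagrams -/

/-- A tail saturated set is null if its trace on the path space of the subdiagram is null. -/
theorem IsErgodicMeasure.null_of_inter_range (hB : B.IsBratteli)
    (hD : (B.vertical W).IsBratteli) {ν : Measure B.Path} (hν : B.IsErgodicMeasure ν)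
    (hsat : ν (B.saturation W)ᶜ = 0) {S : Set B.Path} (hS : MeasurableSet S)
    (hSsat : ∀ x y, B.TailEquiv x y → x ∈ S → y ∈ S)
    (h : ν (S ∩ Set.range (B.verticalIncl W)) = 0) : ν S = 0 := by
  have hn : ∀ n, ν (S ∩ B.staysIn W (n + 1)) = 0 := by
    intro n
    by_contra h0
    have hSn : MeasurableSet (S ∩ B.staysIn W (n + 1)) := hS.inter (measurableSet_staysIn W _)
    obtain ⟨z, ⟨-, hz⟩, hz0⟩ := hB.exists_mem_cyl_ne_zero
      (ν := ν.restrict (S ∩ B.staysIn W (n + 1))) (S := S ∩ B.staysIn W (n + 1))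
      (by rwa [Measure.restrict_apply_self]) (n + 1)
    rw [Measure.restrict_apply (measurableSet_cyl _ _), Set.inter_comm] at hz0
    obtain ⟨y, hy⟩ := exists_vertical_vtx_eq hD n.succ_pos (hz (n + 1) le_rfl)
    rw [hν.inter_cyl_eq hB (x := z) (y := B.verticalIncl W y) hy.symm hSn] at hz0
    · refine hz0 (measure_mono_null ?_ h)
      rintro w ⟨⟨hwS, hw⟩, hwy⟩
      refine ⟨hwS, Set.image_subset_range _ (y.cyl (n + 1)) ?_⟩
      rw [verticalIncl_image_cyl hB y n.succ_pos]
      exact ⟨hw, hwy⟩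
    · intro u w huw hu
      exact ⟨hSsat u w (eventually_atTop.2 ⟨_, huw⟩) hu.1, staysIn_tail huw hu.2⟩
  refine measure_mono_null (t := (⋃ n, S ∩ B.staysIn W (n + 1)) ∪ (B.saturation W)ᶜ) ?_
    (measure_union_null (measure_iUnion_null hn) hsat)
  intro x hx
  by_cases hxW : x ∈ B.saturation W
  · rw [← Set.inter_iUnion]
    exact Or.inl ⟨hx, mem_iUnion_staysIn.2 (saturation_subset B W hxW)⟩
  · exact Or.inr hxW

/-- The saturation in the whole path space of a Borel set of paths of the subdiagram is Borel. -/
theorem measurableSet_saturation_image (hB : B.IsBratteli) (hD : (B.vertical W).IsBratteli)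
    {A : Set (B.vertical W).Path} (hA : MeasurableSet A)
    (hsat : ∀ x y, (B.vertical W).TailEquiv x y → x ∈ A → y ∈ A) :
    MeasurableSet {x : B.Path | ∃ z ∈ A, B.TailEquiv x (B.verticalIncl W z)} := by
  classical
  obtain ⟨y₀⟩ := hD.nonempty_path
  -- a path of the subdiagram through a given vertex, chosen once and for all
  let y : ℕ → L → (B.vertical W).Path := fun n v =>
    if h : ∃ y : (B.vertical W).Path, y.vtx n = v then h.choose else y₀
  have hy : ∀ n (z : (B.vertical W).Path), (y n (z.vtx n)).vtx n = z.vtx n := fun n z => by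
    have h : ∃ y : (B.vertical W).Path, y.vtx n = z.vtx n := ⟨z, rfl⟩
    simp only [y, dif_pos h]
    exact h.choose_spec
  have hset : {x : B.Path | ∃ z ∈ A, B.TailEquiv x (B.verticalIncl W z)} =
      ⋃ n, ⋃ v ∈ B.V n, {x | x.vtx n = v} ∩
        Path.splice n (B.verticalIncl W (y n v)) ⁻¹' (B.verticalIncl W '' A) := by
    ext x
    simp only [Set.mem_iUnion, Set.mem_inter_iff, Set.mem_preimage, Set.mem_ofPred_eq]
    constructor
    · rintro ⟨z, hzA, hz⟩
      obtain ⟨n, hn, hi⟩ := hz.exists_vtx_eq 1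
      have hxn : x ∈ B.staysIn W n := fun i hni => by
        rw [(hi i hni).2]
        exact vtx_vertical_mem z (hn.trans hni)
      have hxz : x.vtx n = z.vtx n := (hi n le_rfl).2
      refine ⟨n, x.vtx n, x.vtx_mem n, rfl, ?_⟩
      obtain ⟨w, hw⟩ := splice_mem_range_verticalIncl (y := y n (x.vtx n)) (n := n)
        (by rw [hxz, hy]) hxn
      refine ⟨w, hsat z w (tailEquiv_verticalIncl.1 ?_) hzA, hw⟩
      rw [hw]
      exact hz.symm.trans (tailEquiv_splice _ _ _)
    · rintro ⟨n, v, -, -, w, hwA, hw⟩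
      exact ⟨w, hwA, hw ▸ tailEquiv_splice _ _ _⟩
  rw [hset]
  refine MeasurableSet.iUnion fun n => (hB.finite_V n).measurableSet_biUnion fun v _ => ?_
  exact (measurableSet_through n v).inter (hB.measurable_splice n _
    ((measurableEmbedding_verticalIncl hB hD).measurableSet_image' hA))

/-- An ergodic measure that lives on the saturation of the path space of a vertical subdiagram, and
is finite on that path space, restricts to an ergodic measure. -/
theorem IsErgodicMeasure.comap_verticalIncl (hB : B.IsBratteli) (hD : (B.vertical W).IsBratteli)
    {ν : Measure B.Path} (hν : B.IsErgodicMeasure ν) (hsat : ν (B.saturation W)ᶜ = 0)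
    (hfin : ν (Set.range (B.verticalIncl W)) ≠ ∞) :
    IsFiniteMeasure (ν.comap (B.verticalIncl W)) ∧
      (B.vertical W).IsErgodicMeasure (ν.comap (B.verticalIncl W)) := by
  have hemb := measurableEmbedding_verticalIncl hB hD
  have hap : ∀ s, ν.comap (B.verticalIncl W) s = ν (B.verticalIncl W '' s) := hemb.comap_apply ν
  have hfinite : IsFiniteMeasure (ν.comap (B.verticalIncl W)) := ⟨by
    rw [hap, Set.image_univ]
    exact hfin.lt_top⟩
  refine ⟨hfinite, ⟨⟨fun x => ?_⟩, inferInstance, ⟨Set.univ, isClopen_univ, ?_, measure_ne_top _ _⟩,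
    hD.isInvariant_iff.2 ?_, fun A hA hAsat => ?_⟩⟩
  · rw [hap, Set.image_singleton]
    exact hν.nonatomic.measure_singleton _
  · rw [hap, Set.image_univ]
    intro h0
    obtain ⟨x, n, hx, -⟩ := hν.exists_cyl hB
    refine hx (measure_mono_null (Set.subset_univ _) (hν.null_of_inter_range hB hD hsat
      MeasurableSet.univ (fun _ _ _ _ => trivial) ?_))
    rwa [Set.univ_inter]
  · intro n x y hxy
    rcases Nat.eq_zero_or_pos n with rfl | hn
    · rw [x.cyl_zero, y.cyl_zero]
    · rw [hap, hap, verticalIncl_image_cyl hB x hn, verticalIncl_image_cyl hB y hn]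
      exact hν.inter_cyl_eq hB hxy (measurableSet_staysIn W n) fun z w h => staysIn_tail h
  · have hmeas := measurableSet_saturation_image hB hD hA hAsat
    rcases hν.ergodic _ hmeas (fun x y hxy ⟨z, hz, hxz⟩ => ⟨z, hz, hxy.symm.trans hxz⟩) with h | h
    · left
      rw [hap]
      refine measure_mono_null ?_ h
      rintro _ ⟨z, hz, rfl⟩
      exact ⟨z, hz, Eventually.of_forall fun _ => rfl⟩
    · right
      rw [hap]
      refine measure_mono_null ?_ h
      rintro _ ⟨w, hw, rfl⟩ ⟨z, hz, hwz⟩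
      exact hw (hAsat z w (tailEquiv_verticalIncl.1 hwz).symm hz)

/-! ### Diagrams with all possible edges -/

/-- Every vertex is joined by an edge to every vertex of the next level. -/
def IsFull (B : LevelGraph L) : Prop :=
  ∀ n, ∀ v ∈ B.V n, ∀ w ∈ B.V (n + 1), ∃ e, B.src n e = v ∧ B.rng n e = w

theorem IsFull.isSimple (hfull : B.IsFull) (hB : B.IsBratteli) : B.IsSimple := by
  refine fun n => ⟨n + 1, n.lt_succ_self, fun v hv w hw => ?_⟩
  obtain ⟨e, hev, hew⟩ := hfull n v hv w hw
  obtain ⟨x, hx⟩ := hB.exists_vtx_eq n hv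
  obtain ⟨z, -, hz⟩ := hB.exists_extend x n e (hev.trans hx.symm)
  refine ⟨⟨fun i => z.1 i, fun i _ _ => z.2 i⟩, ?_, ?_⟩
  · change B.src n (z.1 n) = v
    rw [hz, hev]
  · change B.rng n (z.1 n) = w
    rw [hz, hew]

theorem vertical_isFull (hB : B.IsBratteli)
    (hedge : ∀ n, 1 ≤ n → ∀ w ∈ W, ∀ v ∈ W, ∃ e : B.E n, B.src n e = w ∧ B.rng n e = v) :
    (B.vertical W).IsFull := by
  rintro n v ⟨hv, hvW⟩ w ⟨hw, hwW⟩
  have hwW' := (mem_vertical_level_iff n.succ_pos).1 hwW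
  suffices h : ∃ e : B.E n, B.src n e = v ∧ B.rng n e = w by
    obtain ⟨e, rfl, rfl⟩ := h
    exact ⟨⟨e, hvW, hwW⟩, rfl, rfl⟩
  rcases Nat.eq_zero_or_pos n with rfl | hn
  · obtain ⟨e, he⟩ := hB.exists_rng 0 w hw
    obtain ⟨v₀, h0⟩ := hB.root
    have h1 := B.src_mem 0 e
    rw [h0] at h1 hv
    exact ⟨e, (Set.mem_singleton_iff.1 h1).trans (Set.mem_singleton_iff.1 hv).symm, he⟩
  · exact hedge n hn v ((mem_vertical_level_iff hn).1 hvW) w hwW'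

theorem vertical_isBratteli (hB : B.IsBratteli) (hne : W.Nonempty)
    (hedge : ∀ n, 1 ≤ n → ∀ w ∈ W, ∀ v ∈ W, ∃ e : B.E n, B.src n e = w ∧ B.rng n e = v) :
    (B.vertical W).IsBratteli := by
  have hfull := vertical_isFull hB hedge
  obtain ⟨v₀, h0⟩ := hB.root
  obtain ⟨w, hw⟩ := hne
  have hV : ∀ n, 1 ≤ n → w ∈ (B.vertical W).V n := fun n hn => by
    obtain ⟨e, he, -⟩ := hedge n hn w hw w hw
    exact ⟨he ▸ B.src_mem n e, (mem_vertical_level_iff hn).2 hw⟩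
  have hV0 : (B.vertical W).V 0 = {v₀} := by
    change B.V 0 ∩ Set.univ = _
    rw [Set.inter_univ, h0]
  refine ⟨⟨v₀, hV0⟩, fun n => (hB.finite_V n).subset Set.inter_subset_left, fun n => ?_,
    fun n v hv => ?_, fun n v hv => ?_⟩
  · have := hB.finite_E n
    exact Subtype.finite
  · obtain ⟨e, he, -⟩ := hfull n v hv w (hV (n + 1) n.succ_pos)
    exact ⟨e, he⟩
  · rcases Nat.eq_zero_or_pos n with rfl | hn
    · obtain ⟨e, -, he⟩ := hfull 0 v₀ (by rw [hV0]; rfl) v hv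
      exact ⟨e, he⟩
    · obtain ⟨e, -, he⟩ := hfull n w (hV n hn) v hv
      exact ⟨e, he⟩

theorem IsBratteli.measure_ne_top_of_cyl (hB : B.IsBratteli) {ν : Measure B.Path}
    {S : Set B.Path} (n : ℕ) (h : ∀ x ∈ S, ν (x.cyl n) ≠ ∞) : ν S ≠ ∞ := by
  have hfin : ((fun x : B.Path => x.cyl n) '' S).Finite :=
    (hB.finite_range_cyl n).subset (Set.image_subset_range _ _)
  refine ne_top_of_le_ne_top (b := ν (⋃ s ∈ (fun x : B.Path => x.cyl n) '' S, s)) ?_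
    (measure_mono fun x hx => Set.mem_biUnion ⟨x, hx, rfl⟩ (x.mem_cyl_self n))
  refine (measure_biUnion_lt_top hfin ?_).ne
  rintro _ ⟨x, hx, rfl⟩
  exact (h x hx).lt_top

theorem IsFull.isFiniteMeasure (hfull : B.IsFull) (hB : B.IsBratteli) {ρ : Measure B.Path}
    (hρ : B.IsErgodicMeasure ρ) : IsFiniteMeasure ρ := by
  obtain ⟨x, k, -, hx⟩ := hρ.exists_cyl hB
  refine ⟨(hB.measure_ne_top_of_cyl (k + 1) fun u _ => ?_).lt_top⟩
  obtain ⟨e, he, heu⟩ := hfull k (x.vtx k) (x.vtx_mem k) (u.vtx (k + 1)) (u.vtx_mem _)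
  obtain ⟨z, hzx, hz⟩ := hB.exists_extend x k e he
  have h1 : z.vtx (k + 1) = u.vtx (k + 1) := by rw [← z.rng_eq_vtx, hz, heu]
  rw [← hρ.cyl_eq hB h1]
  exact ne_top_of_le_ne_top hx (measure_mono ((z.cyl_anti k.le_succ).trans (Path.cyl_eq hzx).le))

/-! ### Unique ergodicity -/

theorem measureReal_eq_sum_through [Fintype L] (ρ : Measure B.Path) [IsFiniteMeasure ρ]
    {S : Set B.Path} (hS : MeasurableSet S) (n : ℕ) :
    ρ.real S = ∑ v, ρ.real (S ∩ B.through n v) := by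
  have h4 : S = ⋃ v ∈ Finset.univ, S ∩ B.through n v := by
    ext x
    simp [through]
  conv_lhs => rw [h4]
  refine measureReal_biUnion_finset ?_ fun v _ => hS.inter (measurableSet_through n v)
  intro v _ w _ hvw
  exact Set.disjoint_left.2 fun x hx hx' => hvw (hx.2.symm.trans hx'.2)

/-- If the paths through each vertex have a definite proportion for a finite ergodic measure `ν`,
then every finite invariant measure is a multiple of `ν`. -/
theorem IsErgodicMeasure.eq_smul_of_through_ge [Finite L] (hB : B.IsBratteli) {ν : Measure B.Path}
    (hν : B.IsErgodicMeasure ν) [IsFiniteMeasure ν]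
    (hW : ∀ᶠ n in atTop, ∀ x : B.Path, x.vtx n ∈ W) {δ : ℝ} (hδ : 0 < δ)
    (hge : ∀ v ∈ W, ∀ᶠ n in atTop, δ ≤ ν.real (B.through n v)) {ρ : Measure B.Path}
    [IsFiniteMeasure ρ] (hρ : B.IsInvariant ρ) :
    ρ = (ρ.real Set.univ / ν.real Set.univ).toNNReal • ν := by
  have : Fintype L := Fintype.ofFinite L
  obtain ⟨x₀⟩ := hB.nonempty_path
  have huniv : ν (x₀.cyl 0) ≠ ∞ := measure_ne_top ν _
  have hkey : ∀ (y : B.Path) (l : ℕ), ρ.real (y.cyl l) =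
      ρ.real Set.univ * (ν.real (y.cyl l) / ν.real Set.univ) := by
    intro y l
    set q := ν.real (y.cyl l) / ν.real Set.univ with hq
    -- Given the passage through `v` at level `n`, the cylinder has the same conditional probability
    -- for `ρ` and for `ν`; for `ν` it tends to `q`.
    have hterm : ∀ v, Tendsto (fun n => ρ.real (y.cyl l ∩ B.through n v) -
        ρ.real (Set.univ ∩ B.through n v) * q) atTop (𝓝 0) := by
      intro v
      by_cases hv : v ∈ W
      · have hr := hν.tendsto_ratio huniv (measurableSet_cyl y l)
          (by rw [x₀.cyl_zero]; exact Set.subset_univ _) le_rfl hδ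
          (by simpa only [x₀.cyl_zero, Set.univ_inter] using hge v hv)
        rw [x₀.cyl_zero] at hr
        have hr0 : Tendsto (fun n => ρ.real Set.univ * ‖ν.real (y.cyl l ∩ B.through n v) /
            ν.real (Set.univ ∩ B.through n v) - q‖) atTop (𝓝 0) := by
          have h1 := ((hr.sub_const q).norm).const_mul (ρ.real Set.univ)
          rwa [hq, sub_self, norm_zero, mul_zero] at h1
        refine squeeze_zero_norm' ?_ hr0
        filter_upwards [hge v hv, eventually_ge_atTop l] with n hn hln
        have hpos : 0 < ν.real (Set.univ ∩ B.through n v) := by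
          rw [Set.univ_inter]
          exact hδ.trans_le hn
        have hc := congrArg ENNReal.toReal (hB.measure_cross_mul (hB.isInvariant_iff.1 hρ)
          (hB.isInvariant_iff.1 hν.invariant) hln n.zero_le (f := y) (f' := y) (g := x₀)
          (g' := x₀) rfl rfl v)
        rw [ENNReal.toReal_mul, ENNReal.toReal_mul, x₀.cyl_zero] at hc
        have hc' : ρ.real (y.cyl l ∩ B.through n v) = ρ.real (Set.univ ∩ B.through n v) *
            (ν.real (y.cyl l ∩ B.through n v) / ν.real (Set.univ ∩ B.through n v)) := by
          rw [← mul_div_assoc, eq_div_iff hpos.ne']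
          exact hc
        rw [hc', ← mul_sub, norm_mul, Real.norm_of_nonneg measureReal_nonneg]
        exact mul_le_mul_of_nonneg_right (measureReal_mono (Set.subset_univ _)) (norm_nonneg _)
      · refine tendsto_const_nhds.congr' ?_
        filter_upwards [hW] with n hn
        have h0 : B.through n v = ∅ :=
          Set.eq_empty_of_forall_notMem fun z hz => hv (hz ▸ hn z)
        simp [h0]
    have hsum := tendsto_finsetSum Finset.univ fun v (_ : v ∈ Finset.univ) => hterm v
    rw [Finset.sum_const_zero] at hsum
    have hconst : (fun n => ∑ v, (ρ.real (y.cyl l ∩ B.through n v) -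
        ρ.real (Set.univ ∩ B.through n v) * q)) = fun _ =>
          ρ.real (y.cyl l) - ρ.real Set.univ * q := by
      funext n
      rw [Finset.sum_sub_distrib, ← Finset.sum_mul,
        ← measureReal_eq_sum_through ρ (measurableSet_cyl y l),
        ← measureReal_eq_sum_through ρ MeasurableSet.univ]
    rw [hconst] at hsum
    exact sub_eq_zero.1 (tendsto_nhds_unique tendsto_const_nhds hsum)
  refine hB.measure_ext (G := fun _ => Set.univ) monotone_const (fun _ _ _ => Set.subset_univ _)
    (fun _ _ _ => measure_ne_top ρ _) (fun l y _ => ?_)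
    (by rw [Set.iUnion_const, Set.compl_univ, measure_empty])
    (by rw [Set.iUnion_const, Set.compl_univ, measure_empty])
  rw [Measure.smul_apply, ENNReal.smul_def, smul_eq_mul,
    ← ENNReal.toReal_eq_toReal_iff' (measure_ne_top ρ _)
      (ENNReal.mul_ne_top ENNReal.coe_ne_top (measure_ne_top ν _)), ENNReal.toReal_mul,
    ENNReal.coe_toReal, Real.coe_toNNReal _ (div_nonneg measureReal_nonneg measureReal_nonneg)]
  have := hkey y l
  rw [measureReal_def] at this
  rw [this, measureReal_def ν (y.cyl l)]
  ring

theorem IsErgodicMeasure.measureReal_univ_pos {ν : Measure B.Path} (hν : B.IsErgodicMeasure ν)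
    [IsFiniteMeasure ν] : 0 < ν.real Set.univ := by
  obtain ⟨C, -, hC, -⟩ := hν.exists_clopen
  exact ENNReal.toReal_pos (fun h => hC (measure_mono_null (Set.subset_univ _) h))
    (measure_ne_top _ _)

/-! ### The support of an ergodic probability measure -/

/-- Let the paths through the vertices of `W` have a definite proportion for an ergodic probability
measure, and the paths through the other vertices summable measures.  If moreover all possible
edges between the vertices of `W` exist, then the measure lives on the paths that eventually stay
in `W`, and the vertical subdiagram on `W` is simple and uniquely ergodic. -/
theorem IsErgodicMeasure.vertical_uniquelyErgodic [Finite L] (hB : B.IsBratteli)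
    {μ : Measure B.Path} [IsProbabilityMeasure μ] (hμ : B.IsErgodicMeasure μ) {δ : ℝ} (hδ : 0 < δ)
    (hge : ∀ v ∈ W, ∀ n, 1 ≤ n → δ ≤ μ.real (B.through n v))
    (hsmall : ∀ v ∉ W, ∀ n, μ.real (B.through (n + 1) v) ≤ (1 / 2) ^ n)
    (hedge : ∀ n, 1 ≤ n → ∀ w ∈ W, ∀ v ∈ W, ∃ e : B.E n, B.src n e = w ∧ B.rng n e = v) :
    μ {x | ∀ᶠ n in atTop, x.vtx n ∈ W}ᶜ = 0 ∧ (B.vertical W).IsBratteli ∧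
      (B.vertical W).IsSimple ∧ (B.vertical W).IsUniquelyErgodic ∧
      (B.vertical W).IsErgodicMeasure (μ.comap (B.verticalIncl W)) ∧
      ∀ ρ : Measure (B.vertical W).Path, (B.vertical W).IsErgodicMeasure ρ →
        ∃ c : ℝ≥0, c ≠ 0 ∧ ρ = c • μ.comap (B.verticalIncl W) := by
  have : Fintype L := Fintype.ofFinite L
  have hae : μ {x | ∀ᶠ n in atTop, x.vtx n ∈ W}ᶜ = 0 := by
    have hbound : ∀ n, μ {x : B.Path | x.vtx (n + 1) ∉ W} ≤
        Fintype.card L * ENNReal.ofReal ((1 / 2) ^ n) := by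
      intro n
      classical
      have hsub : {x : B.Path | x.vtx (n + 1) ∉ W} ⊆
          ⋃ v ∈ Finset.univ.filter (· ∉ W), B.through (n + 1) v := by
        intro x hx
        simp only [Set.mem_iUnion]
        exact ⟨x.vtx (n + 1), Finset.mem_filter.2 ⟨Finset.mem_univ _, hx⟩, rfl⟩
      refine (measure_mono hsub).trans ((measure_biUnion_finset_le _ _).trans ?_)
      refine (Finset.sum_le_card_nsmul _ _ (ENNReal.ofReal ((1 / 2) ^ n)) fun v hv => ?_).trans ?_
      · rw [ENNReal.le_ofReal_iff_toReal_le (measure_ne_top μ _) (by positivity)]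
        exact hsmall v (Finset.mem_filter.1 hv).2 n
      · rw [nsmul_eq_mul]
        gcongr
        exact Finset.card_le_univ _
    have hsum : ∑' n, μ {x : B.Path | x.vtx (n + 1) ∉ W} ≠ ∞ := by
      refine ne_top_of_le_ne_top ?_ (ENNReal.tsum_le_tsum hbound)
      rw [ENNReal.tsum_mul_left, ← ENNReal.ofReal_tsum_of_nonneg (fun n => by positivity)
        summable_geometric_two]
      exact ENNReal.mul_ne_top (ENNReal.natCast_ne_top _) ENNReal.ofReal_ne_top
    have hBC := measure_setOfPred_frequently_eq_zero hsum
    refine measure_mono_null (fun x hx => ?_) hBC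
    change ∃ᶠ n in atTop, x.vtx (n + 1) ∉ W
    intro h
    refine hx ?_
    have h1 : ∀ᶠ n in atTop, x.vtx (n + 1) ∈ W := h.mono fun n hn => not_not.1 hn
    exact (eventually_atTop.2 (by
      obtain ⟨N, hN⟩ := eventually_atTop.1 h1
      refine ⟨N + 1, fun i hi => ?_⟩
      obtain ⟨j, rfl⟩ := Nat.exists_eq_succ_of_ne_zero (show i ≠ 0 by omega)
      exact hN j (by omega)))
  have hne : W.Nonempty := by
    by_contra hcon
    rw [Set.not_nonempty_iff_eq_empty] at hcon
    have : {x : B.Path | ∀ᶠ n in atTop, x.vtx n ∈ W}ᶜ = Set.univ := by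
      refine Set.eq_univ_of_forall fun x hx => ?_
      obtain ⟨n, hn⟩ := Eventually.exists hx
      rw [hcon] at hn
      exact hn
    rw [this, measure_univ] at hae
    exact one_ne_zero hae
  have hfull := vertical_isFull hB hedge
  have hD := vertical_isBratteli hB hne hedge
  have hsat : μ (B.saturation W)ᶜ = 0 := by rw [saturation_eq hD]; exact hae
  obtain ⟨hfin, herg⟩ := hμ.comap_verticalIncl hB hD hsat (measure_ne_top μ _)
  set η := μ.comap (B.verticalIncl W) with hη
  have hemb := measurableEmbedding_verticalIncl hB hD
  have hap : ∀ s, η s = μ (B.verticalIncl W '' s) := hemb.comap_apply μ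
  have hηpos := herg.measureReal_univ_pos
  set Y := Set.range (B.verticalIncl W) with hY
  have hηY : η.real Set.univ = μ.real Y := by
    rw [measureReal_def, hap, Set.image_univ, measureReal_def]
  -- asymptotic independence of the path space of the subdiagram and the passage through `v`
  have hηge : ∀ v ∈ W, ∀ᶠ n in atTop,
      δ * η.real Set.univ / 2 ≤ η.real ((B.vertical W).through n v) := by
    intro v hv
    obtain ⟨x₀⟩ := hB.nonempty_path
    have hlim := hμ.tendsto_inter_through (x := x₀) (k := 0) (measure_ne_top μ _)
      hemb.measurableSet_range (by rw [x₀.cyl_zero]; exact Set.subset_univ _) v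
    rw [x₀.cyl_zero] at hlim
    simp only [probReal_univ, mul_one, Set.univ_inter] at hlim
    have hpos : 0 < δ * η.real Set.univ / 2 := by positivity
    filter_upwards [hlim.eventually (lt_mem_nhds (show -(δ * η.real Set.univ / 2) < 0 by linarith)),
      eventually_ge_atTop 1] with n hn hn1
    have h1 : η.real ((B.vertical W).through n v) = μ.real (Y ∩ B.through n v) := by
      rw [measureReal_def, hap, measureReal_def]
      have : (B.vertical W).through n v = B.verticalIncl W ⁻¹' B.through n v := rfl
      rw [this, Set.image_preimage_eq_inter_range, Set.inter_comm]
    rw [h1]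
    have h2 := mul_le_mul_of_nonneg_left (hge v hv n hn1) hηpos.le
    rw [hηY] at h2 hn ⊢
    linarith
  have hW : ∀ᶠ n in atTop, ∀ x : (B.vertical W).Path, x.vtx n ∈ W :=
    (eventually_ge_atTop 1).mono fun n hn x => vtx_vertical_mem x hn
  have huniq : ∀ ρ : Measure (B.vertical W).Path, IsFiniteMeasure ρ →
      (B.vertical W).IsInvariant ρ → ρ = (ρ.real Set.univ / η.real Set.univ).toNNReal • η :=
    fun ρ hρ hinv => herg.eq_smul_of_through_ge hD hW (by positivity) hηge hinv
  refine ⟨hae, hD, hfull.isSimple hD, ?_, herg, fun ρ hρ => ?_⟩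
  · have hη0 : η Set.univ ≠ 0 := fun h => by
      rw [measureReal_def, h, ENNReal.toReal_zero] at hηpos
      exact lt_irrefl _ hηpos
    refine ⟨(η Set.univ)⁻¹ • η, ⟨⟨?_⟩, ⟨fun x => ?_⟩, fun n e f hef => ?_⟩, ?_⟩
    · rw [Measure.smul_apply, smul_eq_mul, ENNReal.inv_mul_cancel hη0 (measure_ne_top η _)]
    · rw [Measure.smul_apply, herg.nonatomic.measure_singleton, smul_zero]
    · rw [Measure.smul_apply, Measure.smul_apply, herg.invariant n e f hef]
    · rintro ρ ⟨hρ, -, hinv⟩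
      have h1 := huniq ρ inferInstance hinv
      rw [probReal_univ] at h1
      rw [h1]
      ext s -
      rw [Measure.smul_apply, Measure.smul_apply, ENNReal.smul_def, smul_eq_mul, smul_eq_mul]
      congr 1
      change ENNReal.ofReal _ = _
      rw [one_div, ENNReal.ofReal_inv_of_pos hηpos, ofReal_measureReal]
  · have := hfull.isFiniteMeasure hD hρ
    refine ⟨_, ?_, huniq ρ inferInstance hρ.invariant⟩
    exact (Real.toNNReal_pos.2 (div_pos hρ.measureReal_univ_pos hηpos)).ne'

end Subdiagrams

section Telescoping

/-! ### Telescoping -/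

theorem exists_mem_Ico_of_strictMono {m : ℕ → ℕ} (hm : StrictMono m) (h0 : m 0 = 0) (i : ℕ) :
    ∃ j, i ∈ Set.Ico (m j) (m (j + 1)) := by
  induction i with
  | zero => exact ⟨0, h0.le, by simpa [h0] using hm Nat.zero_lt_one⟩
  | succ i ih =>
    obtain ⟨j, hj1, hj2⟩ := ih
    rcases (Nat.succ_le_of_lt hj2).lt_or_eq with h | h
    · exact ⟨j, hj1.trans i.le_succ, h⟩
    · exact ⟨j + 1, h.ge, by rw [← Nat.succ_eq_add_one i, h]; exact hm (Nat.lt_succ_self _)⟩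

theorem mem_Ico_unique_of_strictMono {m : ℕ → ℕ} (hm : StrictMono m) {i j k : ℕ}
    (hj : i ∈ Set.Ico (m j) (m (j + 1))) (hk : i ∈ Set.Ico (m k) (m (k + 1))) : j = k := by
  have h1 := hm.lt_iff_lt.1 (hj.1.trans_lt hk.2)
  have h2 := hm.lt_iff_lt.1 (hk.1.trans_lt hj.2)
  omega

variable {m : ℕ → ℕ} {hm : StrictMono m}

theorem telescopeMap_preimage_through (k : ℕ) (v : L) :
    B.telescopeMap m hm ⁻¹' (B.telescope m hm).through k v = B.through (m k) v := rfl

theorem telescopeMap_apply_eq_iff {x y : B.Path} {k : ℕ} :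
    (B.telescopeMap m hm x).1 k = (B.telescopeMap m hm y).1 k ↔
      ∀ i ∈ Set.Ico (m k) (m (k + 1)), x.1 i = y.1 i := by
  constructor
  · intro h i hi
    exact congrFun (congrArg Subtype.val h) ⟨i, hi⟩
  · intro h
    exact Subtype.ext (funext fun i => h i.1 i.2)

theorem telescopeMap_preimage_cyl (h0 : m 0 = 0) (x : B.Path) (k : ℕ) :
    B.telescopeMap m hm ⁻¹' (B.telescopeMap m hm x).cyl k = x.cyl (m k) := by
  ext y
  constructor
  · intro h i hi
    obtain ⟨j, hj⟩ := exists_mem_Ico_of_strictMono hm h0 i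
    exact telescopeMap_apply_eq_iff.1 (h j (hm.lt_iff_lt.1 (hj.1.trans_lt hi))) i hj
  · intro h j hj
    exact telescopeMap_apply_eq_iff.2 fun i hi => h i (hi.2.trans_le (hm.monotone hj))

theorem telescopeMap_injective (h0 : m 0 = 0) : Function.Injective (B.telescopeMap m hm) := by
  intro x y h
  refine Path.ext fun i => ?_
  obtain ⟨j, hj⟩ := exists_mem_Ico_of_strictMono hm h0 i
  exact telescopeMap_apply_eq_iff.1 (congrFun (congrArg Subtype.val h) j) i hj

theorem telescopeMap_surjective (h0 : m 0 = 0) : Function.Surjective (B.telescopeMap m hm) := by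
  intro x'
  choose k hk using exists_mem_Ico_of_strictMono hm h0
  let x : (i : ℕ) → B.E i := fun i => (x'.1 (k i)).1 ⟨i, hk i⟩
  have hx : ∀ j i (h : i ∈ Set.Ico (m j) (m (j + 1))), x i = (x'.1 j).1 ⟨i, h⟩ := by
    intro j i h
    obtain rfl := mem_Ico_unique_of_strictMono hm h (hk i)
    rfl
  refine ⟨⟨x, fun i => ?_⟩, Subtype.ext (funext fun j => Subtype.ext (funext fun i => ?_))⟩
  · obtain ⟨j, hj1, hj2⟩ := exists_mem_Ico_of_strictMono hm h0 i
    rcases (Nat.succ_le_of_lt hj2).lt_or_eq with h | h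
    · rw [hx j i ⟨hj1, hj2⟩, hx j (i + 1) ⟨hj1.trans i.le_succ, h⟩]
      exact (x'.1 j).2 i _ _
    · have hi : i + 1 = m (j + 1) := h
      have hi' : i + 1 ∈ Set.Ico (m (j + 1)) (m (j + 1 + 1)) :=
        ⟨hi.ge, hi ▸ hm (Nat.lt_succ_self _)⟩
      rw [hx j i ⟨hj1, hj2⟩, hx (j + 1) (i + 1) hi']
      -- at a boundary level this is the matching of consecutive edges of the telescoped path
      have hcompat := x'.2 j
      have h1 : ∀ (a : ℕ) (ha : a = i + 1) (h2 : a - 1 ∈ Set.Ico (m j) (m (j + 1))),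
          B.rng (a - 1) ((x'.1 j).1 ⟨a - 1, h2⟩) = B.rng i ((x'.1 j).1 ⟨i, hj1, hj2⟩) := by
        rintro a rfl h2
        rfl
      have h2 : ∀ (a : ℕ) (ha : a = i + 1) (h3 : a ∈ Set.Ico (m (j + 1)) (m (j + 1 + 1))),
          B.src a ((x'.1 (j + 1)).1 ⟨a, h3⟩) =
            B.src (i + 1) ((x'.1 (j + 1)).1 ⟨i + 1, hi'⟩) := by
        rintro a rfl h3
        rfl
      rw [← h1 (m (j + 1)) hi.symm ⟨Nat.le_sub_one_of_lt (hm j.lt_succ_self),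
        Nat.sub_one_lt_of_lt (hm j.lt_succ_self)⟩,
        ← h2 (m (j + 1)) hi.symm ⟨le_rfl, hm (Nat.lt_succ_self _)⟩]
      exact hcompat
  · exact hx j i.1 i.2

theorem IsBratteli.telescope (hB : B.IsBratteli) (h0 : m 0 = 0) (hm : StrictMono m) :
    (B.telescope m hm).IsBratteli := by
  refine ⟨?_, fun n => hB.finite_V _, fun n => ?_, fun n v hv => ?_, fun n v hv => ?_⟩
  · change ∃ v₀, B.V (m 0) = {v₀}
    rw [h0]
    exact hB.root
  · have := hB.finite_E
    exact Subtype.finite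
  · obtain ⟨x, hx⟩ := hB.exists_vtx_eq (m n) hv
    exact ⟨(B.telescopeMap m hm x).1 n, hx⟩
  · obtain ⟨x, hx⟩ := hB.exists_vtx_eq (m (n + 1)) hv
    exact ⟨(B.telescopeMap m hm x).1 n, ((B.telescopeMap m hm x).rng_eq_vtx n).trans hx⟩

theorem measurable_telescopeMap (hB : B.IsBratteli) (h0 : m 0 = 0) :
    Measurable (B.telescopeMap m hm) := by
  refine (hB.telescope h0 hm).measurable_of_coord fun n p => ?_
  have : {x | (B.telescopeMap m hm x).1 n = p} =
      ⋂ i : Set.Ico (m n) (m (n + 1)), {x : B.Path | x.1 i.1 ∈ ({p.1 i} : Set (B.E i.1))} := by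
    ext x
    rw [Set.mem_iInter]
    exact ⟨fun h i => congrFun (congrArg Subtype.val h) i, fun h => Subtype.ext (funext h)⟩
  rw [this]
  exact MeasurableSet.iInter fun i => measurableSet_coord _ _

theorem TailEquiv.telescopeMap {x y : B.Path} (h : B.TailEquiv x y) :
    (B.telescope m hm).TailEquiv (B.telescopeMap m hm x) (B.telescopeMap m hm y) := by
  obtain ⟨n, hn⟩ := eventually_atTop.1 h
  refine eventually_atTop.2 ⟨n, fun k hk => telescopeMap_apply_eq_iff.2 fun i hi => ?_⟩
  exact hn i (hk.trans (hm.le_apply.trans hi.1))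

theorem IsErgodicMeasure.map_telescopeMap (hB : B.IsBratteli) (h0 : m 0 = 0)
    {μ : Measure B.Path} [IsProbabilityMeasure μ] (hμ : B.IsErgodicMeasure μ) :
    (B.telescope m hm).IsErgodicMeasure (μ.map (B.telescopeMap m hm)) := by
  have hT := measurable_telescopeMap (hm := hm) hB h0
  have hB' := hB.telescope h0 hm
  have hprob : IsProbabilityMeasure (μ.map (B.telescopeMap m hm)) :=
    Measure.isProbabilityMeasure_map hT.aemeasurable
  refine ⟨⟨fun x' => ?_⟩, inferInstance, ⟨Set.univ, isClopen_univ, by simp, by simp⟩,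
    hB'.isInvariant_iff.2 ?_, fun A hA hsat => ?_⟩
  · obtain ⟨x, rfl⟩ := telescopeMap_surjective h0 x'
    rw [Measure.map_apply hT (measurableSet_path_singleton _), ← Set.image_singleton,
      Set.preimage_image_eq _ (telescopeMap_injective h0)]
    exact hμ.nonatomic.measure_singleton x
  · intro n x' y' h
    obtain ⟨x, rfl⟩ := telescopeMap_surjective h0 x'
    obtain ⟨y, rfl⟩ := telescopeMap_surjective h0 y'
    rw [Measure.map_apply hT (measurableSet_cyl _ _), Measure.map_apply hT (measurableSet_cyl _ _),
      telescopeMap_preimage_cyl h0, telescopeMap_preimage_cyl h0]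
    exact hμ.cyl_eq hB h
  · rw [Measure.map_apply hT hA, Measure.map_apply hT hA.compl]
    exact hμ.ergodic _ (hT hA) fun x y hxy hx => hsat _ _ hxy.telescopeMap hx

end Telescoping

/-! ### The choice of levels -/

/-- The labels that keep a definite proportion of the paths, along an ultrafilter of levels. -/
def recurrentLabels (𝒰 : Ultrafilter ℕ) (μ : Measure B.Path) : Set L :=
  {v | ∃ δ : ℝ, 0 < δ ∧ ∀ᶠ n in 𝒰, δ ≤ μ.real (B.through n v)}

/-- Different ergodic probability measures have disjoint sets of recurrent labels. -/
theorem eq_of_mem_recurrentLabels (hB : B.IsBratteli) {𝒰 : Ultrafilter ℕ}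
    (h𝒰 : (𝒰 : Filter ℕ) ≤ atTop) {μ ν : Measure B.Path} [IsProbabilityMeasure μ]
    [IsProbabilityMeasure ν] (hμ : B.IsErgodicMeasure μ) (hν : B.IsErgodicMeasure ν) {v : L}
    (hv : v ∈ recurrentLabels 𝒰 μ) (hv' : v ∈ recurrentLabels 𝒰 ν) : μ = ν := by
  obtain ⟨δ, hδ, h⟩ := hv
  obtain ⟨δ', hδ', h'⟩ := hv'
  obtain ⟨x⟩ := hB.nonempty_path
  obtain ⟨c, -, rfl⟩ := hμ.exists_smul_eq hB hν h𝒰 (x := x) (x' := x) (k := 0) (k' := 0)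
    (measure_ne_top _ _) (measure_ne_top _ _) hδ hδ' (by simpa [x.cyl_zero] using h)
    (by simpa [x.cyl_zero] using h')
  have h1 := measure_univ (μ := c • μ)
  rw [Measure.smul_apply, measure_univ, ENNReal.smul_def, smul_eq_mul, mul_one,
    ENNReal.coe_eq_one] at h1
  rw [h1, one_smul]

/-- There are finitely many ergodic probability measures, since each of them has a recurrent label
of its own. -/
theorem finite_ergodic_probability [Finite L] (hB : B.IsBratteli) :
    {μ : Measure B.Path | IsProbabilityMeasure μ ∧ B.IsErgodicMeasure μ}.Finite := by
  have hex : ∀ μ : Measure B.Path, IsProbabilityMeasure μ ∧ B.IsErgodicMeasure μ →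
      ∃ v, v ∈ recurrentLabels (hyperfilter ℕ) μ := by
    rintro μ ⟨hμ, -⟩
    obtain ⟨v, δ, hδ, h⟩ := exists_through_ge (ν := μ) (S := Set.univ) (by simp) (by simp)
      (hyperfilter ℕ)
    exact ⟨v, δ, hδ, by simpa using h⟩
  choose f hf using hex
  refine Set.finite_coe_iff.1 ?_
  refine Finite.of_injective (fun μ : {μ : Measure B.Path | IsProbabilityMeasure μ ∧
    B.IsErgodicMeasure μ} => f μ.1 μ.2) fun μ ν h => Subtype.ext ?_
  have := μ.2.1
  have := ν.2.1
  have h1 := hf ν.1 ν.2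
  rw [← show f μ.1 μ.2 = f ν.1 ν.2 from h] at h1
  exact eq_of_mem_recurrentLabels hB Nat.hyperfilter_le_atTop μ.2.2 ν.2.2 (hf μ.1 μ.2) h1

theorem exists_recurrentLabels_bound [Finite L] (𝒰 : Ultrafilter ℕ) (μ : Measure B.Path) :
    ∃ δ : ℝ, 0 < δ ∧ ∀ v ∈ recurrentLabels 𝒰 μ, ∀ᶠ n in 𝒰, δ ≤ μ.real (B.through n v) := by
  have hex : ∀ v, ∃ δ : ℝ, 0 < δ ∧ (v ∈ recurrentLabels 𝒰 μ →
      ∀ᶠ n in 𝒰, δ ≤ μ.real (B.through n v)) := by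
    intro v
    by_cases hv : v ∈ recurrentLabels 𝒰 μ
    · obtain ⟨δ, hδ, h⟩ := hv
      exact ⟨δ, hδ, fun _ => h⟩
    · exact ⟨1, one_pos, fun h => absurd h hv⟩
  choose f hf0 hf using hex
  have : Fintype L := Fintype.ofFinite L
  rcases isEmpty_or_nonempty L with hL | hL
  · exact ⟨1, one_pos, fun v => isEmptyElim v⟩
  · refine ⟨Finset.univ.inf' Finset.univ_nonempty f, ?_, fun v hv => ?_⟩
    · rw [Finset.lt_inf'_iff]
      exact fun v _ => hf0 v
    · exact (hf v hv).mono fun n hn => (Finset.inf'_le _ (Finset.mem_univ v)).trans hn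

theorem eventually_lt_of_notMem_recurrentLabels {𝒰 : Ultrafilter ℕ} {μ : Measure B.Path} {v : L}
    (hv : v ∉ recurrentLabels 𝒰 μ) {ε : ℝ} (hε : 0 < ε) :
    ∀ᶠ n in 𝒰, μ.real (B.through n v) < ε := by
  by_contra h
  have h1 := Ultrafilter.eventually_not.2 h
  exact hv ⟨ε, hε, h1.mono fun n hn => not_lt.1 hn⟩

/-- Vertices with recurrent labels are joined by finite paths to the vertices with recurrent labels
of most later levels. -/
theorem eventually_joined_of_mem_recurrentLabels (hB : B.IsBratteli) {𝒰 : Ultrafilter ℕ}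
    (h𝒰 : (𝒰 : Filter ℕ) ≤ atTop) {μ : Measure B.Path} [IsProbabilityMeasure μ]
    (hμ : B.IsErgodicMeasure μ) {v w : L} (hv : v ∈ recurrentLabels 𝒰 μ) {j : ℕ}
    (hw : μ (B.through j w) ≠ 0) :
    ∀ᶠ n in 𝒰, ∃ x : B.Path, x.vtx j = w ∧ x.vtx n = v := by
  obtain ⟨δ, hδ, h⟩ := hv
  obtain ⟨x⟩ := hB.nonempty_path
  have hlim := hμ.tendsto_ratio (x := x) (k := 0) (measure_ne_top _ _)
    (measurableSet_through j w) (by rw [x.cyl_zero]; exact Set.subset_univ _) h𝒰 hδ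
    (by simpa [x.cyl_zero] using h)
  rw [x.cyl_zero, probReal_univ, div_one] at hlim
  have hpos : 0 < μ.real (B.through j w) := ENNReal.toReal_pos hw (measure_ne_top _ _)
  filter_upwards [hlim.eventually (lt_mem_nhds hpos)] with n hn
  have h1 : μ (B.through j w ∩ B.through n v) ≠ 0 := by
    intro h0
    rw [measureReal_def, h0, ENNReal.toReal_zero, zero_div] at hn
    exact lt_irrefl _ hn
  obtain ⟨z, hz⟩ := nonempty_of_measure_ne_zero h1
  exact ⟨z, hz.1, hz.2⟩

/-- Levels along which the recurrent labels of every ergodic probability measure keep a definite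
proportion, the other labels have summable proportions, and the recurrent labels of consecutive
levels are joined by finite paths. -/
theorem exists_levels [Finite L] (hB : B.IsBratteli) {𝒰 : Ultrafilter ℕ}
    (h𝒰 : (𝒰 : Filter ℕ) ≤ atTop) :
    ∃ m : ℕ → ℕ, StrictMono m ∧ m 0 = 0 ∧
      ∀ μ : Measure B.Path, IsProbabilityMeasure μ → B.IsErgodicMeasure μ →
        (∃ δ : ℝ, 0 < δ ∧ ∀ v ∈ recurrentLabels 𝒰 μ, ∀ k, 1 ≤ k →
          δ ≤ μ.real (B.through (m k) v)) ∧
        (∀ v ∉ recurrentLabels 𝒰 μ, ∀ k, μ.real (B.through (m (k + 1)) v) ≤ (1 / 2) ^ k) ∧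
        (∀ k, 1 ≤ k → ∀ w ∈ recurrentLabels 𝒰 μ, ∀ v ∈ recurrentLabels 𝒰 μ,
          ∃ x : B.Path, x.vtx (m k) = w ∧ x.vtx (m (k + 1)) = v) := by
  have hfin := finite_ergodic_probability hB
  set 𝓔 := {μ : Measure B.Path | IsProbabilityMeasure μ ∧ B.IsErgodicMeasure μ} with h𝓔
  choose δ hδ0 hδ using fun μ : Measure B.Path => exists_recurrentLabels_bound 𝒰 μ
  let good : ℕ → Prop := fun j => ∀ μ ∈ 𝓔, ∀ v ∈ recurrentLabels 𝒰 μ,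
    δ μ ≤ μ.real (B.through j v)
  -- one step of the choice: a good level `n` after a given level `j`
  have hstep : ∀ (k j : ℕ), ∃ n, j < n ∧ good n ∧
      (∀ μ ∈ 𝓔, ∀ v ∉ recurrentLabels 𝒰 μ, μ.real (B.through n v) ≤ (1 / 2) ^ k) ∧
      (good j → ∀ μ ∈ 𝓔, ∀ w ∈ recurrentLabels 𝒰 μ, ∀ v ∈ recurrentLabels 𝒰 μ,
        ∃ x : B.Path, x.vtx j = w ∧ x.vtx n = v) := by
    intro k j
    have h1 : ∀ᶠ n in (𝒰 : Filter ℕ), j < n := h𝒰 (eventually_gt_atTop j)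
    have h2 : ∀ᶠ n in (𝒰 : Filter ℕ), good n := by
      refine (eventually_all_finite hfin).2 fun μ _ => ?_
      exact (eventually_all_finite (Set.toFinite _)).2 fun v hv => hδ μ v hv
    have h3 : ∀ᶠ n in (𝒰 : Filter ℕ), ∀ μ ∈ 𝓔, ∀ v ∈ (recurrentLabels 𝒰 μ)ᶜ,
        μ.real (B.through n v) ≤ (1 / 2) ^ k := by
      refine (eventually_all_finite hfin).2 fun μ _ => ?_
      refine (eventually_all_finite (Set.toFinite _)).2 fun v hv => ?_
      exact (eventually_lt_of_notMem_recurrentLabels hv (by positivity)).mono fun n hn => hn.le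
    have h4 : ∀ᶠ n in (𝒰 : Filter ℕ), good j → ∀ μ ∈ 𝓔, ∀ w ∈ recurrentLabels 𝒰 μ,
        ∀ v ∈ recurrentLabels 𝒰 μ, ∃ x : B.Path, x.vtx j = w ∧ x.vtx n = v := by
      by_cases hj : good j
      · simp only [hj, true_imp_iff]
        refine (eventually_all_finite hfin).2 fun μ hμ => ?_
        have := hμ.1
        refine (eventually_all_finite (Set.toFinite _)).2 fun w hw => ?_
        refine (eventually_all_finite (Set.toFinite _)).2 fun v hv => ?_
        refine eventually_joined_of_mem_recurrentLabels hB h𝒰 hμ.2 hv fun h0 => ?_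
        have h5 := hj μ hμ w hw
        rw [measureReal_def, h0, ENNReal.toReal_zero] at h5
        exact (hδ0 μ).not_ge h5
      · simp [hj]
    obtain ⟨n, hn1, hn2, hn3, hn4⟩ := (h1.and (h2.and (h3.and h4))).exists
    exact ⟨n, hn1, hn2, hn3, hn4⟩
  choose next hnext using hstep
  let m : ℕ → ℕ := fun k => Nat.rec 0 next k
  have hm : ∀ k, m (k + 1) = next k (m k) := fun k => rfl
  have hgood : ∀ k, 1 ≤ k → good (m k) := by
    intro k hk
    obtain ⟨j, rfl⟩ := Nat.exists_eq_succ_of_ne_zero (show k ≠ 0 by omega)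
    exact (hnext j (m j)).2.1
  refine ⟨m, strictMono_nat_of_lt_succ fun k => (hnext k (m k)).1, rfl, fun μ hμ hμ' =>
    ⟨⟨δ μ, hδ0 μ, fun v hv k hk => hgood k hk μ ⟨hμ, hμ'⟩ v hv⟩,
      fun v hv k => (hnext k (m k)).2.2.1 μ ⟨hμ, hμ'⟩ v hv, fun k hk w hw v hv => ?_⟩⟩
  exact (hnext k (m k)).2.2.2 (hgood k hk) μ ⟨hμ, hμ'⟩ w hw v hv

/-! ### Supports and towers of ergodic probability measures -/

/-- Along suitable levels, every ergodic probability measure has a set of labels that satisfies the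
hypotheses of `IsErgodicMeasure.vertical_uniquelyErgodic` in the telescoped diagram. -/
theorem exists_telescope_supports [Finite L] (hB : B.IsBratteli) :
    ∃ (m : ℕ → ℕ) (hm : StrictMono m), m 0 = 0 ∧
      ∃ W : Measure B.Path → Set L,
        (∀ μ : Measure B.Path, IsProbabilityMeasure μ → B.IsErgodicMeasure μ →
          μ.map (B.telescopeMap m hm)
            {x | ∀ᶠ n in atTop, (B.telescope m hm).rng n (x.1 n) ∈ W μ}ᶜ = 0 ∧
          (∀ ν : Measure B.Path, IsProbabilityMeasure ν → B.IsErgodicMeasure ν → μ ≠ ν →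
            Disjoint (W μ) (W ν)) ∧
          (∃ δ : ℝ≥0∞, 0 < δ ∧ ∀ v ∈ W μ, ∀ n,
            δ ≤ μ.map (B.telescopeMap m hm) ((B.telescope m hm).tower n v)) ∧
          ((B.telescope m hm).vertical (W μ)).IsBratteli ∧
          ((B.telescope m hm).vertical (W μ)).IsSimple ∧
          ((B.telescope m hm).vertical (W μ)).IsUniquelyErgodic ∧
          ((B.telescope m hm).vertical (W μ)).IsErgodicMeasure
            ((μ.map (B.telescopeMap m hm)).comap ((B.telescope m hm).verticalIncl (W μ))) ∧
          (∀ ρ : Measure ((B.telescope m hm).vertical (W μ)).Path,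
            ((B.telescope m hm).vertical (W μ)).IsErgodicMeasure ρ →
            ∃ c : ℝ≥0, c ≠ 0 ∧ ρ = c •
              (μ.map (B.telescopeMap m hm)).comap
                ((B.telescope m hm).verticalIncl (W μ)))) := by
  obtain ⟨m, hm, h0, hlev⟩ := exists_levels hB Nat.hyperfilter_le_atTop
  refine ⟨m, hm, h0, recurrentLabels (hyperfilter ℕ), fun μ hμ hμe => ?_⟩
  obtain ⟨⟨δ, hδ, hge⟩, hsmall, hjoin⟩ := hlev μ hμ hμe
  have hT := measurable_telescopeMap (hm := hm) hB h0
  have hB' := hB.telescope h0 hm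
  have hμ' := hμe.map_telescopeMap (hm := hm) hB h0
  have hprob : IsProbabilityMeasure (μ.map (B.telescopeMap m hm)) :=
    Measure.isProbabilityMeasure_map hT.aemeasurable
  have hthrough : ∀ k v, (μ.map (B.telescopeMap m hm)) ((B.telescope m hm).through k v) =
      μ (B.through (m k) v) := fun k v => by
    rw [Measure.map_apply hT (measurableSet_through k v), telescopeMap_preimage_through]
  have hreal : ∀ k v, (μ.map (B.telescopeMap m hm)).real ((B.telescope m hm).through k v) =
      μ.real (B.through (m k) v) := fun k v => congrArg ENNReal.toReal (hthrough k v)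
  have hedge : ∀ n, 1 ≤ n → ∀ w ∈ recurrentLabels (hyperfilter ℕ) μ,
      ∀ v ∈ recurrentLabels (hyperfilter ℕ) μ, ∃ e : (B.telescope m hm).E n,
        (B.telescope m hm).src n e = w ∧ (B.telescope m hm).rng n e = v := by
    intro n hn w hw v hv
    obtain ⟨x, hxw, hxv⟩ := hjoin n hn w hw v hv
    exact ⟨(B.telescopeMap m hm x).1 n, hxw,
      ((B.telescopeMap m hm x).rng_eq_vtx n).trans hxv⟩
  obtain ⟨hae, hD, hsimple, huniq, herg, hmult⟩ := hμ'.vertical_uniquelyErgodic hB' hδ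
    (fun v hv n hn => (hge v hv n hn).trans_eq (hreal n v).symm)
    (fun v hv n => (hreal (n + 1) v).trans_le (hsmall v hv n)) hedge
  refine ⟨?_, fun ν hν hνe hne => ?_, ⟨ENNReal.ofReal δ, ENNReal.ofReal_pos.2 hδ, fun v hv n => ?_⟩,
    hD, hsimple, huniq, herg, hmult⟩
  · refine measure_mono_null (Set.compl_subset_compl.2 fun x hx => ?_) hae
    have h1 := (tendsto_add_atTop_nat 1).eventually
      (show ∀ᶠ n in atTop, x.vtx n ∈ recurrentLabels (hyperfilter ℕ) μ from hx)
    exact h1.mono fun n hn => (x.rng_eq_vtx n).symm ▸ hn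
  · exact Set.disjoint_left.2 fun v hv hv' =>
      hne (eq_of_mem_recurrentLabels hB Nat.hyperfilter_le_atTop hμe hνe hv hv')
  · rw [tower_eq_through, hthrough, ENNReal.ofReal_le_iff_le_toReal (measure_ne_top _ _)]
    exact hge v hv (n + 1) n.succ_pos

/-- The measure of the towers outside the vertical subdiagram tends to zero, since almost every path
eventually stays in the subdiagram. -/
theorem IsExtension.tendsto_tower {W : Set L} {μ : Measure B.Path} [IsFiniteMeasure μ]
    {ρ : Measure (B.vertical W).Path} (h : B.IsExtension W μ ρ) {v : L} (hv : v ∉ W) :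
    Tendsto (fun n => μ (B.tower n v)) atTop (𝓝 0) := by
  have hlim := tendsto_measure_iInter_atTop (μ := μ) (s := fun n => (B.staysIn W (n + 1))ᶜ)
    (fun n => (measurableSet_staysIn W _).compl.nullMeasurableSet)
    (fun i j hij => Set.compl_subset_compl.2 (staysIn_mono W (Nat.succ_le_succ hij)))
    ⟨0, measure_ne_top _ _⟩
  have h0 : μ (⋂ n, (B.staysIn W (n + 1))ᶜ) = 0 := by
    rw [← Set.compl_iUnion]
    refine measure_mono_null (Set.compl_subset_compl.2 fun x hx => ?_) h.saturation_compl
    exact mem_iUnion_staysIn.2 (saturation_subset B W hx)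
  rw [h0] at hlim
  refine tendsto_of_tendsto_of_tendsto_of_le_of_le tendsto_const_nhds hlim (fun _ => zero_le)
    fun n => measure_mono fun x hx hx' => hv ?_
  rw [tower_eq_through] at hx
  exact hx ▸ hx' (n + 1) le_rfl

section Extension

variable {W : Set L}

/-! ### Extension of measures from a vertical subdiagram -/

theorem isClopen_cyl (x : B.Path) (n : ℕ) : IsClopen (x.cyl n) := by
  refine ⟨⟨isOpen_of_cyl_subset (m := n) fun y hy z hz hzx => hy ?_⟩, isOpen_cyl x n⟩
  rw [← Path.cyl_eq hzx]
  exact Path.mem_cyl_symm hz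

/-- No path leaves `W` and returns to it, from level `1` on. -/
def NoReturn (B : LevelGraph L) (W : Set L) : Prop :=
  ∀ (x : B.Path) (i j k : ℕ), 1 ≤ i → i ≤ j → j ≤ k → x.vtx i ∈ W → x.vtx k ∈ W → x.vtx j ∈ W

theorem NoReturn.mem_staysIn (hW : B.NoReturn W) {x : B.Path} {n : ℕ} (hn : 1 ≤ n)
    (hx : x.vtx n ∈ W) (hxs : x ∈ B.saturation W) : x ∈ B.staysIn W n := by
  obtain ⟨N, hN⟩ := eventually_atTop.1 (saturation_subset B W hxs)
  exact fun i hi => hW x n i (max i N) hn hi (le_max_left _ _) hx (hN _ (le_max_right _ _))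

/-- For a measure that lives on the saturation, passing through `W` means staying in `W`. -/
theorem NoReturn.measure_inter_staysIn (hW : B.NoReturn W) {ν : Measure B.Path}
    (hν : ν (B.saturation W)ᶜ = 0) {n : ℕ} (hn : 1 ≤ n) {S : Set B.Path}
    (hS : ∀ x ∈ S, x.vtx n ∈ W) : ν (B.staysIn W n ∩ S) = ν S := by
  refine le_antisymm (measure_mono Set.inter_subset_right) ?_
  have hsub : S ⊆ (B.staysIn W n ∩ S) ∪ (B.saturation W)ᶜ := by
    intro x hx
    by_cases h : x ∈ B.saturation W
    · exact Or.inl ⟨hW.mem_staysIn hn (hS x hx) h, hx⟩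
    · exact Or.inr h
  refine (measure_mono hsub).trans ((measure_union_le _ _).trans ?_)
  rw [hν, add_zero]

theorem IsExtension.measure_cyl (hB : B.IsBratteli) (hD : (B.vertical W).IsBratteli)
    (hW : B.NoReturn W) {ν : Measure B.Path} {μ : Measure (B.vertical W).Path}
    (h : B.IsExtension W ν μ) {z : B.Path} {w : (B.vertical W).Path} {m : ℕ} (hm : 1 ≤ m)
    (hzw : w.vtx m = z.vtx m) : ν (z.cyl m) = μ (w.cyl m) := by
  have h1 : ∀ x ∈ (B.verticalIncl W w).cyl m, x.vtx m ∈ W := fun x hx => by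
    rw [hB.vtx_of_mem_cyl hx le_rfl]
    exact vtx_vertical_mem w hm
  rw [← hB.isInvariant_iff.1 h.invariant m (B.verticalIncl W w) z hzw,
    ← hW.measure_inter_staysIn h.saturation_compl hm h1, ← verticalIncl_image_cyl hB w hm,
    ← h.restriction, (measurableEmbedding_verticalIncl hB hD).comap_apply]

/-- A finite measure on the path space of the subdiagram has at most one extension. -/
theorem IsExtension.unique (hB : B.IsBratteli) (hD : (B.vertical W).IsBratteli)
    (hW : B.NoReturn W) {ν ν' : Measure B.Path} {μ : Measure (B.vertical W).Path}
    [IsFiniteMeasure μ] (h : B.IsExtension W ν μ) (h' : B.IsExtension W ν' μ) : ν = ν' := by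
  let G : ℕ → Set B.Path := fun m => {z | ∃ j, 1 ≤ j ∧ j ≤ m ∧ z.vtx j ∈ W}
  have hval : ∀ {η : Measure B.Path}, B.IsExtension W η μ → ∀ m, ∀ z ∈ G m, z.vtx m ∉ W →
      η (z.cyl m) = 0 := by
    rintro η hη m z ⟨j, hj, hjm, hzj⟩ hzm
    refine measure_mono_null (t := (B.saturation W)ᶜ) (fun x hx hxs => hzm ?_)
      hη.saturation_compl
    rw [← hB.vtx_of_mem_cyl hx le_rfl]
    refine hW.mem_staysIn hj ?_ hxs m hjm
    rwa [hB.vtx_of_mem_cyl hx hjm]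
  -- a cylinder in `G m` that does not end in `W` has left `W` and is null
  have hcyl : ∀ m, ∀ z ∈ G m, ν (z.cyl m) ≠ ∞ ∧ ν (z.cyl m) = ν' (z.cyl m) := by
    intro m z hz
    by_cases hzm : z.vtx m ∈ W
    · have hm : 1 ≤ m := by
        obtain ⟨j, hj, hjm, -⟩ := hz
        exact hj.trans hjm
      obtain ⟨w, hw⟩ := exists_vertical_vtx_eq hD hm hzm
      rw [h.measure_cyl hB hD hW hm hw, h'.measure_cyl hB hD hW hm hw]
      exact ⟨measure_ne_top _ _, rfl⟩
    · rw [hval h m z hz hzm, hval h' m z hz hzm]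
      exact ⟨ENNReal.zero_ne_top, rfl⟩
  have hcover : (⋃ m, G m)ᶜ ⊆ (B.saturation W)ᶜ := by
    refine Set.compl_subset_compl.2 fun x hx => ?_
    obtain ⟨n, hn⟩ := Set.mem_iUnion.1 (mem_iUnion_staysIn.2 (saturation_subset B W hx))
    exact Set.mem_iUnion.2 ⟨n + 1, n + 1, n.succ_pos, le_rfl, hn _ le_rfl⟩
  refine hB.measure_ext (G := G) (fun a b hab z ⟨j, hj, hja, hz⟩ => ⟨j, hj, hja.trans hab, hz⟩)
    ?_ (fun m z hz => (hcyl m z hz).1) (fun m z hz => (hcyl m z hz).2)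
    (measure_mono_null hcover h.saturation_compl) (measure_mono_null hcover h'.saturation_compl)
  rintro m z ⟨j, hj, hjm, hz⟩ x hx
  exact ⟨j, hj, hjm, by rwa [hB.vtx_of_mem_cyl hx hjm]⟩

/-- The path `x` enters `W` for the first time at level `n`. -/
def Path.EntersAt (W : Set L) (x : B.Path) (n : ℕ) : Prop :=
  1 ≤ n ∧ x.vtx n ∈ W ∧ ∀ j, 1 ≤ j → j < n → x.vtx j ∉ W

theorem Path.EntersAt.eq {x : B.Path} {m n : ℕ} (hm : x.EntersAt W m) (hn : x.EntersAt W n) :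
    m = n := by
  rcases lt_trichotomy m n with h | h | h
  · exact absurd hm.2.1 (hn.2.2 m hm.1 h)
  · exact h
  · exact absurd hn.2.1 (hm.2.2 n hn.1 h)

theorem Path.exists_entersAt {x : B.Path} {m : ℕ} (hm : 1 ≤ m) (hx : x.vtx m ∈ W) :
    ∃ n ≤ m, x.EntersAt W n := by
  classical
  have hex : ∃ n, 1 ≤ n ∧ x.vtx n ∈ W := ⟨m, hm, hx⟩
  exact ⟨Nat.find hex, Nat.find_min' hex ⟨hm, hx⟩, (Nat.find_spec hex).1, (Nat.find_spec hex).2,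
    fun j hj hjn hjW => Nat.find_min hex hjn ⟨hj, hjW⟩⟩

theorem IsBratteli.entersAt_of_mem_cyl (hB : B.IsBratteli) {x y : B.Path} {n : ℕ}
    (h : x.EntersAt W n) (hy : y ∈ x.cyl n) : y.EntersAt W n :=
  ⟨h.1, by rw [hB.vtx_of_mem_cyl hy le_rfl]; exact h.2.1, fun j hj hjn => by
    rw [hB.vtx_of_mem_cyl hy hjn.le]
    exact h.2.2 j hj hjn⟩

/-- The cylinders that end at the first entry to `W`. -/
def entryCylinders (B : LevelGraph L) (W : Set L) : Set (Set B.Path) :=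
  {s | ∃ (x : B.Path) (n : ℕ), s = x.cyl n ∧ x.EntersAt W n}

/-- The extension of a measure is the sum, over all cylinders that end at the first entry to `W`, of
the images of the measure under exchange of the initial segments. -/
theorem exists_extension_measure (hB : B.IsBratteli) (hD : (B.vertical W).IsBratteli)
    (μ : Measure (B.vertical W).Path) :
    ∃ (n : B.entryCylinders W → ℕ) (x : B.entryCylinders W → B.Path)
      (y : B.entryCylinders W → (B.vertical W).Path) (ν : Measure B.Path),
      (∀ s, s.1 = (x s).cyl (n s)) ∧ (∀ s, (x s).EntersAt W (n s)) ∧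
      (∀ s, (y s).vtx (n s) = (x s).vtx (n s)) ∧
      ∀ A, MeasurableSet A → ν A = ∑' s, μ ((y s).cyl (n s) ∩
        {u | Path.splice (n s) (x s) (B.verticalIncl W u) ∈ A}) := by
  choose x n hs hx using fun s : B.entryCylinders W => s.2
  choose y hy using fun s => exists_vertical_vtx_eq hD (hx s).1 (hx s).2.1
  refine ⟨n, x, y, Measure.sum fun s => (μ.restrict ((y s).cyl (n s))).map fun u =>
    Path.splice (n s) (x s) (B.verticalIncl W u), hs, hx, hy, fun A hA => ?_⟩
  rw [Measure.sum_apply _ hA]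
  refine tsum_congr fun s => ?_
  have hmeas : Measurable fun u => Path.splice (n s) (x s) (B.verticalIncl W u) :=
    (hB.measurable_splice (n s) (x s)).comp (measurable_verticalIncl hB)
  rw [Measure.map_apply hmeas hA, Measure.restrict_apply (hmeas hA), Set.inter_comm]
  rfl

/-- A finite ergodic measure on the path space of a vertical subdiagram to which paths do not
return has an ergodic extension. -/
theorem IsErgodicMeasure.exists_extension [Finite L] (hB : B.IsBratteli)
    (hD : (B.vertical W).IsBratteli) (hW : B.NoReturn W) {μ : Measure (B.vertical W).Path}
    [IsFiniteMeasure μ] (hμ : (B.vertical W).IsErgodicMeasure μ) :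
    ∃ ν : Measure B.Path, B.IsExtension W ν μ ∧ B.IsErgodicMeasure ν := by
  have : Fintype L := Fintype.ofFinite L
  obtain ⟨n, x, y, ν, hs, hx, hy, hν⟩ := exists_extension_measure hB hD μ
  have htail : ∀ s u, B.TailEquiv (B.verticalIncl W u)
      (Path.splice (n s) (x s) (B.verticalIncl W u)) := fun s u => tailEquiv_splice _ _ _
  have hsatmeas : MeasurableSet (B.saturation W) := by
    have : B.saturation W = ⋃ n, B.staysIn W (n + 1) := by
      rw [saturation_eq hD]
      exact Set.ext fun x => mem_iUnion_staysIn.symm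
    rw [this]
    exact MeasurableSet.iUnion fun n => measurableSet_staysIn W _
  have hsat : ν (B.saturation W)ᶜ = 0 := by
    rw [hν _ hsatmeas.compl, ENNReal.tsum_eq_zero]
    intro s
    have : {u | Path.splice (n s) (x s) (B.verticalIncl W u) ∈ (B.saturation W)ᶜ} = ∅ :=
      Set.eq_empty_of_forall_notMem fun u hu => hu ⟨u, (htail s u).symm⟩
    rw [this, Set.inter_empty, measure_empty]
  -- a cylinder that ends in `W` meets a single entry cylinder
  have hcyl : ∀ (m : ℕ) (z : B.Path) (w : (B.vertical W).Path), 1 ≤ m → w.vtx m = z.vtx m →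
      ν (z.cyl m) = μ (w.cyl m) := by
    intro m z w hm hwz
    have hzW : z.vtx m ∈ W := hwz ▸ vtx_vertical_mem w hm
    obtain ⟨k, hkm, hk⟩ := z.exists_entersAt hm hzW
    let s₀ : B.entryCylinders W := ⟨z.cyl k, z, k, rfl, hk⟩
    have hz0 : z ∈ (x s₀).cyl (n s₀) := by
      rw [← hs s₀]
      exact z.mem_cyl_self k
    have hk0 : n s₀ = k := (hB.entersAt_of_mem_cyl (hx s₀) hz0).eq hk
    have hnm : n s₀ ≤ m := hk0.trans_le hkm
    rw [hν _ (measurableSet_cyl z m), tsum_eq_single s₀]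
    · have hyz : (B.verticalIncl W (y s₀)).vtx (n s₀) = z.vtx (n s₀) :=
        (hy s₀).trans (hB.vtx_of_mem_cyl hz0 le_rfl).symm
      set q := Path.splice (n s₀) (B.verticalIncl W (y s₀)) z with hq
      have hqm : q.vtx m = w.vtx m := (Path.vtx_splice_ge _ _ _ hnm).trans hwz.symm
      have hqw : Path.splice m q (B.verticalIncl W w) ∈ Set.range (B.verticalIncl W) := by
        rw [range_verticalIncl]
        intro i hi
        rcases le_total m i with hmi | him
        · rw [Path.vtx_splice_ge _ _ _ hmi]
          exact vtx_vertical_mem w hi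
        · rw [Path.vtx_splice_le hqm him]
          rcases le_total (n s₀) i with hni | hin
          · rw [hq, Path.vtx_splice_ge _ _ _ hni]
            refine hW z (n s₀) i m (hx s₀).1 hni him ?_ hzW
            rw [hk0]
            exact hk.2.1
          · rw [hq, Path.vtx_splice_le hyz hin]
            exact vtx_vertical_mem (y s₀) hi
      obtain ⟨w', hw'⟩ := hqw
      have hww : w'.vtx m = w.vtx m := by
        rw [← vtx_verticalIncl, hw', Path.vtx_splice_ge _ _ _ le_rfl, vtx_verticalIncl]
      have hset : (y s₀).cyl (n s₀) ∩
          {u | Path.splice (n s₀) (x s₀) (B.verticalIncl W u) ∈ z.cyl m} = w'.cyl m := by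
        have h1 := congrArg (fun S => B.verticalIncl W ⁻¹' S)
          (hB.cyl_inter_preimage_splice (x := B.verticalIncl W (y s₀)) (y := x s₀) (hy s₀) hz0 hnm)
        simp only [Set.preimage_inter, verticalIncl_preimage_cyl] at h1
        rw [← verticalIncl_preimage_cyl w', hw', Path.cyl_eq (Path.splice_mem_cyl hqm)]
        exact h1
      rw [hset, hD.isInvariant_iff.1 hμ.invariant m w' w hww]
    · intro s hne
      have : (y s).cyl (n s) ∩
          {u | Path.splice (n s) (x s) (B.verticalIncl W u) ∈ z.cyl m} = ∅ := by
        refine Set.eq_empty_of_forall_notMem fun u ⟨hu, hu'⟩ => ?_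
        have hxu : (x s).vtx (n s) = (B.verticalIncl W u).vtx (n s) := by
          rw [vtx_verticalIncl, hD.vtx_of_mem_cyl hu le_rfl, hy s]
        have hmem := Path.splice_mem_cyl hxu
        rcases le_or_gt (n s) m with h | h
        · have h1 := z.cyl_anti h hu'
          have h2 : z ∈ (x s).cyl (n s) := by
            rw [← Path.cyl_eq hmem, Path.cyl_eq h1]
            exact z.mem_cyl_self _
          have h3 : n s = k := (hB.entersAt_of_mem_cyl (hx s) h2).eq hk
          refine hne (Subtype.ext ?_)
          change s.1 = z.cyl k
          rw [hs s, ← Path.cyl_eq h2, h3]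
        · refine (hx s).2.2 m hm h ?_
          rw [← hB.vtx_of_mem_cyl hmem h.le, hB.vtx_of_mem_cyl hu' le_rfl]
          exact hzW
      rw [this, measure_empty]
  have hinv : ∀ (m : ℕ) (z z' : B.Path), z.vtx m = z'.vtx m → ν (z.cyl m) = ν (z'.cyl m) := by
    intro m z z' hzz
    -- the part of a cylinder that stays in `W` from level `M` on is counted by paths to level `M`
    have hM : ∀ M, m ≤ M → 1 ≤ M →
        ν (z.cyl m ∩ B.staysIn W M) = ν (z'.cyl m ∩ B.staysIn W M) := by
      intro M hmM hM1
      classical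
      have hsum : ∀ u : B.Path, ν (u.cyl m ∩ B.staysIn W M) =
          ∑ v ∈ Finset.univ.filter (· ∈ W), ν (u.cyl m ∩ B.through M v) := by
        intro u
        rw [Set.inter_comm, ← measure_biUnion_finset]
        · have h1 := hW.measure_inter_staysIn hsat hM1
            (S := ⋃ v ∈ Finset.univ.filter (· ∈ W), u.cyl m ∩ B.through M v) (by
              intro p hp
              simp only [Set.mem_iUnion] at hp
              obtain ⟨v, hv, -, hpv⟩ := hp
              exact Set.mem_of_eq_of_mem hpv (Finset.mem_filter.1 hv).2)
          rw [← h1]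
          congr 1
          ext p
          refine and_congr_right fun hp => ?_
          simp only [Set.mem_iUnion]
          exact ⟨fun h => ⟨p.vtx M, Finset.mem_filter.2 ⟨Finset.mem_univ _, hp M le_rfl⟩, h, rfl⟩,
            fun ⟨v, _, h, _⟩ => h⟩
        · exact fun v _ v' _ hvv => Set.disjoint_left.2 fun p hp hp' =>
            hvv (hp.2.symm.trans hp'.2)
        · exact fun v _ => (measurableSet_cyl u m).inter (measurableSet_through M v)
      rw [hsum, hsum]
      refine Finset.sum_congr rfl fun v hv => ?_
      have hvW := (Finset.mem_filter.1 hv).2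
      by_cases hex : ∃ w : (B.vertical W).Path, w.vtx M = v
      · obtain ⟨w, rfl⟩ := hex
        have hp : ∀ u : B.Path, u.vtx M = w.vtx M → ν (u.cyl M) = μ (w.cyl M) :=
          fun u hu => hcyl M u w hM1 hu.symm
        rw [hB.measure_cyl_inter_through hmM hp, hB.measure_cyl_inter_through hmM hp,
          hB.numPaths_eq hmM hzz]
      · have h0 : B.through M v = ∅ := by
          refine Set.eq_empty_of_forall_notMem fun u hu => hex ?_
          obtain ⟨w, hw⟩ := exists_vertical_vtx_eq (x := u) hD hM1
            (Set.mem_of_eq_of_mem (show u.vtx M = v from hu) hvW)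
          exact ⟨w, hw.trans hu⟩
        rw [h0, Set.inter_empty, Set.inter_empty]
    have hlim : ∀ u : B.Path, ν (u.cyl m) = ⨆ M, ν (u.cyl m ∩ B.staysIn W (m + M + 1)) := by
      intro u
      rw [← Monotone.measure_iUnion (fun i j hij => Set.inter_subset_inter_right _
        (staysIn_mono W (by omega)))]
      refine le_antisymm ?_ (measure_mono (Set.iUnion_subset fun _ => Set.inter_subset_left))
      rw [← Set.inter_iUnion]
      refine (measure_mono (t := (u.cyl m ∩ ⋃ M, B.staysIn W (m + M + 1)) ∪
        (B.saturation W)ᶜ) fun p hp => ?_).trans ((measure_union_le _ _).trans (by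
          rw [hsat, add_zero]))
      by_cases hps : p ∈ B.saturation W
      · obtain ⟨N, hN⟩ := Set.mem_iUnion.1 (mem_iUnion_staysIn.2 (saturation_subset B W hps))
        exact Or.inl ⟨hp, Set.mem_iUnion.2 ⟨N, staysIn_mono W (by omega) hN⟩⟩
      · exact Or.inr hps
    rw [hlim, hlim]
    exact iSup_congr fun M => hM _ (by omega) (by omega)
  have hemb := measurableEmbedding_verticalIncl hB hD
  have hrestr : ν.comap (B.verticalIncl W) = μ := by
    have hval : ∀ m, 1 ≤ m → ∀ w : (B.vertical W).Path,
        ν.comap (B.verticalIncl W) (w.cyl m) = μ (w.cyl m) := by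
      intro m hm w
      rw [hemb.comap_apply, verticalIncl_image_cyl hB w hm, hW.measure_inter_staysIn hsat hm
        fun p hp => ?_]
      · exact hcyl m _ w hm rfl
      · rw [hB.vtx_of_mem_cyl hp le_rfl]
        exact vtx_vertical_mem w hm
    have hcover : (⋃ m : ℕ, {_w : (B.vertical W).Path | 1 ≤ m})ᶜ = ∅ := by
      rw [Set.compl_empty_iff]
      exact Set.eq_univ_of_forall fun w => Set.mem_iUnion.2 ⟨1, le_refl 1⟩
    refine hD.measure_ext (G := fun m => {_w | 1 ≤ m}) (fun i j hij _ h => le_trans h hij)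
      (fun m _ h _ _ => h) (fun m w hm => ?_) (fun m w hm => hval m hm w) ?_ ?_
    · rw [hval m hm w]
      exact measure_ne_top _ _
    · rw [hcover, measure_empty]
    · rw [hcover, measure_empty]
  refine ⟨ν, ⟨hB.isInvariant_iff.2 hinv, hsat, hrestr⟩, ⟨⟨fun p => ?_⟩, ?_, ?_,
    hB.isInvariant_iff.2 hinv, fun A hA hAsat => ?_⟩⟩
  · rw [hν _ (measurableSet_path_singleton p), ENNReal.tsum_eq_zero]
    intro s
    have := hμ.nonatomic
    refine Set.Subsingleton.measure_zero (fun u hu u' hu' => Path.ext fun i => ?_) μ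
    rcases lt_or_ge i (n s) with hi | hi
    · rw [hu.1 i hi, hu'.1 i hi]
    · have h1 : Path.splice (n s) (x s) (B.verticalIncl W u) =
          Path.splice (n s) (x s) (B.verticalIncl W u') := hu.2.trans hu'.2.symm
      have h2 := congrArg (fun q => q.1 i) h1
      simp only [Path.splice_apply_ge _ _ _ hi] at h2
      exact Subtype.ext h2
  · refine ⟨⟨⟨fun k => (B.saturation W)ᶜ ∪ B.staysIn W (k + 1), fun _ => trivial, fun k => ?_, ?_⟩⟩⟩
    · refine (measure_union_le _ _).trans_lt ?_
      rw [hsat, zero_add]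
      refine (hB.measure_ne_top_of_cyl (k + 1) fun z hz => ?_).lt_top
      obtain ⟨w, hw⟩ := exists_vertical_vtx_eq hD k.succ_pos (hz (k + 1) le_rfl)
      rw [hcyl (k + 1) z w k.succ_pos hw]
      exact measure_ne_top _ _
    · refine Set.eq_univ_of_forall fun z => ?_
      rw [← Set.union_iUnion]
      by_cases hz : z ∈ B.saturation W
      · exact Or.inr (mem_iUnion_staysIn.2 (saturation_subset B W hz))
      · exact Or.inl hz
  · have h0 : μ Set.univ ≠ 0 := fun h0 => by
      obtain ⟨C, -, hC, -⟩ := hμ.exists_clopen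
      exact hC (measure_mono_null (Set.subset_univ _) h0)
    obtain ⟨w, -, hw⟩ := hD.exists_mem_cyl_ne_zero h0 1
    refine ⟨(B.verticalIncl W w).cyl 1, isClopen_cyl _ _, ?_⟩
    rw [hcyl 1 _ w le_rfl rfl]
    exact ⟨hw, measure_ne_top _ _⟩
  · have hpre : ∀ A : Set B.Path, MeasurableSet A → (∀ z z', B.TailEquiv z z' → z ∈ A → z' ∈ A) →
        μ (B.verticalIncl W ⁻¹' A) = 0 → ν A = 0 := by
      intro A hA hAsat h0
      rw [hν A hA, ENNReal.tsum_eq_zero]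
      exact fun s => measure_mono_null (fun u hu => hAsat _ _ (htail s u).symm hu.2) h0
    refine (hμ.ergodic (B.verticalIncl W ⁻¹' A) (hemb.measurable hA) fun u u' huu hu =>
      hAsat _ _ (tailEquiv_verticalIncl.2 huu) hu).imp (hpre A hA hAsat) (hpre Aᶜ hA.compl ?_)
    exact fun z z' hzz hz hz' => hz (hAsat _ _ hzz.symm hz')

end Extension

end LevelGraph

namespace LevelGraph

variable {d r s : ℕ} {B : LevelGraph (Fin d)} {b : Fin d → Fin r}

/-! ### Diagrams in block-triangular form -/

theorem IsBratteli.incidence_ne_zero_iff (hB : B.IsBratteli) {n : ℕ} {v w : Fin d} :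
    B.incidence n v w ≠ 0 ↔ ∃ e : B.E n, B.rng n e = v ∧ B.src n e = w := by
  have := hB.finite_E n
  rw [incidence, Nat.card_ne_zero, nonempty_subtype, and_iff_left]
  exact Subtype.finite

/-- The block of the vertices of a path is non-decreasing. -/
theorem IsBlockTriangular.block_mono (hB : B.IsBratteli) (hb : B.IsBlockTriangular s b)
    (x : B.Path) {i j : ℕ} (hi : 1 ≤ i) (hij : i ≤ j) : b (x.vtx i) ≤ b (x.vtx j) := by
  induction j, hij using Nat.le_induction with
  | base => exact le_rfl
  | succ j hij ih =>
    refine ih.trans (not_lt.1 fun h => ?_)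
    refine hB.incidence_ne_zero_iff.2 ⟨x.1 j, x.rng_eq_vtx j, rfl⟩
      (hb.upper_zero j (hi.trans hij) _ _ h)

theorem IsBlockTriangular.noReturn (hB : B.IsBratteli) (hb : B.IsBlockTriangular s b)
    (α : Fin r) : B.NoReturn (b ⁻¹' {α}) := by
  intro x i j k hi hij hjk hxi hxk
  refine le_antisymm ?_ ?_
  · exact (hb.block_mono hB x (hi.trans hij) hjk).trans_eq hxk
  · exact (Set.mem_singleton_iff.1 hxi).symm.trans_le (hb.block_mono hB x hi hij)

/-- Every path eventually stays in one block. -/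
theorem IsBlockTriangular.exists_eventually_mem (hB : B.IsBratteli)
    (hb : B.IsBlockTriangular s b) (x : B.Path) :
    ∃ α, ∀ᶠ n in atTop, x.vtx n ∈ b ⁻¹' {α} := by
  obtain ⟨N, hN⟩ := WellFoundedGT.monotone_chain_condition
    (⟨fun n => b (x.vtx (n + 1)), fun i j hij => hb.block_mono hB x i.succ_pos
      (Nat.succ_le_succ hij)⟩ : ℕ →o Fin r)
  refine ⟨b (x.vtx (N + 1)), eventually_atTop.2 ⟨N + 1, fun n hn => ?_⟩⟩
  obtain ⟨k, rfl⟩ := Nat.exists_eq_succ_of_ne_zero (show n ≠ 0 by omega)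
  exact (hN k (by omega)).symm

/-- A diagonal block is strictly positive as soon as one of its entries is non-zero. -/
theorem IsBlockTriangular.pos_of_ne_zero (hb : B.IsBlockTriangular s b) {α : Fin r} {k : ℕ}
    (hk : 1 ≤ k) {v₀ w₀ : Fin d} (hv₀ : b v₀ = α) (hw₀ : b w₀ = α)
    (h : B.incidence k v₀ w₀ ≠ 0) {n : ℕ} (hn : 1 ≤ n) {v w : Fin d} (hv : b v = α)
    (hw : b w = α) : 0 < B.incidence n v w := by
  rcases lt_or_ge (α : ℕ) s with hα | hα
  · exact hb.min_pos n hn v w (hv ▸ hα) (hw.trans hv.symm)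
  · rcases hb.pos_or_zero α hα with h1 | h1
    · exact h1 n hn v w hv hw
    · exact absurd (h1 k hk v₀ w₀ hv₀ hw₀) h

theorem IsBlockTriangular.exists_edge (hB : B.IsBratteli) (hb : B.IsBlockTriangular s b)
    {α : Fin r} (hα : B.IsNonzeroBlock b α) (n : ℕ) (hn : 1 ≤ n) (w : Fin d)
    (hw : w ∈ b ⁻¹' {α}) (v : Fin d) (hv : v ∈ b ⁻¹' {α}) :
    ∃ e : B.E n, B.src n e = w ∧ B.rng n e = v := by
  obtain ⟨v₀, w₀, hv₀, hw₀, h⟩ := hα 1 le_rfl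
  obtain ⟨e, he, he'⟩ := hB.incidence_ne_zero_iff.1
    (hb.pos_of_ne_zero le_rfl hv₀ hw₀ h hn hv hw).ne'
  exact ⟨e, he', he⟩

/-- An ergodic measure lives on the paths that eventually stay in some non-zero block, and it is
finite on the path space of that block. -/
theorem IsBlockTriangular.exists_block (hB : B.IsBratteli) (hb : B.IsBlockTriangular s b)
    {ν : Measure B.Path} (hν : B.IsErgodicMeasure ν) :
    ∃ α : Fin r, B.IsNonzeroBlock b α ∧ ν (B.saturation (b ⁻¹' {α}))ᶜ = 0 ∧
      ν (Set.range (B.verticalIncl (b ⁻¹' {α}))) ≠ ∞ := by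
  let S : Fin r → Set B.Path := fun α => ⋃ n, B.staysIn (b ⁻¹' {α}) (n + 1)
  have hSmeas : ∀ α, MeasurableSet (S α) :=
    fun α => MeasurableSet.iUnion fun n => measurableSet_staysIn _ _
  have hSsat : ∀ α x y, B.TailEquiv x y → x ∈ S α → y ∈ S α := by
    intro α x y hxy hx
    refine mem_iUnion_staysIn.2 ?_
    filter_upwards [mem_iUnion_staysIn.1 hx, hxy] with n hn hn'
    rwa [Path.vtx, ← hn']
  obtain ⟨α, hα⟩ : ∃ α, ν (S α) ≠ 0 := by
    by_contra! hcon
    obtain ⟨x, n, hx, -⟩ := hν.exists_cyl hB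
    refine hx (measure_mono_null (fun z _ => ?_) (measure_iUnion_null hcon))
    obtain ⟨α, hα⟩ := hb.exists_eventually_mem hB z
    exact Set.mem_iUnion.2 ⟨α, mem_iUnion_staysIn.2 hα⟩
  have hnull : ν (S α)ᶜ = 0 := hν.compl_null (hSmeas α) (hSsat α) hα
  obtain ⟨z, hzS, hzfin⟩ : ∃ z ∈ S α, z ∈ ⋃ m, finitePart ν m := by
    by_contra! hcon
    exact hα (measure_mono_null (fun z hz => hcon z hz) (hν.finitePart_compl hB))
  obtain ⟨N, hN⟩ := Set.mem_iUnion.1 hzS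
  obtain ⟨M, hM⟩ := Set.mem_iUnion.1 hzfin
  set n := max M (N + 1) with hn
  have hn1 : 1 ≤ n := le_trans N.succ_pos (le_max_right _ _)
  have hzn : z ∈ B.staysIn (b ⁻¹' {α}) n := staysIn_mono _ (le_max_right _ _) hN
  have hznfin : ν (z.cyl n) ≠ ∞ := finitePart_mono ν (le_max_left _ _) hM
  have hzα : B.IsNonzeroBlock b α := fun k hk =>
    ⟨z.vtx n, z.vtx n, hzn n le_rfl, hzn n le_rfl,
      (hb.pos_of_ne_zero hn1 (hzn (n + 1) n.le_succ) (hzn n le_rfl)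
        (hB.incidence_ne_zero_iff.2 ⟨z.1 n, z.rng_eq_vtx n, rfl⟩) hk (hzn n le_rfl)
        (hzn n le_rfl)).ne'⟩
  have hedge := hb.exists_edge hB hzα
  have hD := vertical_isBratteli hB ⟨z.vtx n, hzn n le_rfl⟩ hedge
  refine ⟨α, hzα, ?_, hB.measure_ne_top_of_cyl (n + 1) fun x hx => ?_⟩
  · refine measure_mono_null (Set.compl_subset_compl.2 fun x hx => ?_) hnull
    rw [saturation_eq hD]
    exact mem_iUnion_staysIn.1 hx
  · rw [range_verticalIncl] at hx
    -- by positivity the vertex of `x` at level `n + 1` is reached from the finite cylinder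
    obtain ⟨e, he, hex⟩ := hedge n hn1 (z.vtx n) (hzn n le_rfl) (x.vtx (n + 1))
      (hx (n + 1) n.succ_pos)
    obtain ⟨u, hu, hue⟩ := hB.exists_extend z n e he
    have h1 : u.vtx (n + 1) = x.vtx (n + 1) := by rw [← u.rng_eq_vtx, hue, hex]
    rw [← hν.cyl_eq hB h1]
    exact ne_top_of_le_ne_top hznfin
      (measure_mono ((u.cyl_anti n.le_succ).trans (Path.cyl_eq hu).le))

end LevelGraph

theorem mainTheorem1 (d : ℕ) (B : LevelGraph (Fin d)) (hB : B.IsBratteli)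
    (hd : ∀ n, B.V (n + 1) = Set.univ) :
    -- (1), (2): ergodic measures of a diagram in block-triangular form
    (∀ (r s : ℕ) (b : Fin d → Fin r), B.IsBlockTriangular s b →
      (∀ α : Fin r, B.IsNonzeroBlock b α →
        ∀ μ : Measure (B.vertical (b ⁻¹' {α})).Path, IsFiniteMeasure μ →
          (B.vertical (b ⁻¹' {α})).IsErgodicMeasure μ →
          ∃ ν : Measure B.Path, B.IsExtension (b ⁻¹' {α}) ν μ ∧ B.IsErgodicMeasure ν ∧
            ∀ ν' : Measure B.Path, B.IsExtension (b ⁻¹' {α}) ν' μ → ν' = ν) ∧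
      (∀ ν : Measure B.Path, B.IsErgodicMeasure ν →
        ∃ α : Fin r, B.IsNonzeroBlock b α ∧
          ∃ μ : Measure (B.vertical (b ⁻¹' {α})).Path, IsFiniteMeasure μ ∧
            (B.vertical (b ⁻¹' {α})).IsErgodicMeasure μ ∧
            B.IsExtension (b ⁻¹' {α}) ν μ)) ∧
    -- (3): up to scalar multiples there are at most `d` ergodic measures, finite or infinite
    (∃ S : Finset (Measure B.Path), S.card ≤ d ∧
      ∀ ν : Measure B.Path, B.IsErgodicMeasure ν → ∃ ρ ∈ S, ∃ c : ℝ≥0, c ≠ 0 ∧ ν = c • ρ) ∧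
    -- (4): supports of the ergodic probability measures, after telescoping
    (∃ (m : ℕ → ℕ) (hm : StrictMono m), m 0 = 0 ∧
      ∃ W : Measure B.Path → Set (Fin d),
        (∀ μ : Measure B.Path, IsProbabilityMeasure μ → B.IsErgodicMeasure μ →
          μ.map (B.telescopeMap m hm)
            {x | ∀ᶠ n in atTop, (B.telescope m hm).rng n (x.1 n) ∈ W μ}ᶜ = 0 ∧
          (∀ ν : Measure B.Path, IsProbabilityMeasure ν → B.IsErgodicMeasure ν → μ ≠ ν →
            Disjoint (W μ) (W ν)) ∧
          (∃ δ : ℝ≥0∞, 0 < δ ∧ ∀ v ∈ W μ, ∀ n,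
            δ ≤ μ.map (B.telescopeMap m hm) ((B.telescope m hm).tower n v)) ∧
          ((B.telescope m hm).vertical (W μ)).IsBratteli ∧
          ((B.telescope m hm).vertical (W μ)).IsSimple ∧
          ((B.telescope m hm).vertical (W μ)).IsUniquelyErgodic ∧
          ((B.telescope m hm).vertical (W μ)).IsErgodicMeasure
            ((μ.map (B.telescopeMap m hm)).comap ((B.telescope m hm).verticalIncl (W μ))) ∧
          (∀ ρ : Measure ((B.telescope m hm).vertical (W μ)).Path,
            ((B.telescope m hm).vertical (W μ)).IsErgodicMeasure ρ →
            ∃ c : ℝ≥0, c ≠ 0 ∧ ρ = c •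
              (μ.map (B.telescopeMap m hm)).comap
                ((B.telescope m hm).verticalIncl (W μ))))) ∧
    -- (5): towers outside the vertical subdiagram that a measure is extended from
    (∀ μ : Measure B.Path, IsProbabilityMeasure μ → B.IsErgodicMeasure μ →
      ∀ W : Set (Fin d), W ≠ Set.univ → ∀ ρ : Measure (B.vertical W).Path,
        B.IsExtension W μ ρ →
        ∀ v ∉ W, Tendsto (fun n => μ (B.tower n v)) atTop (𝓝 0)) := by
  refine ⟨fun r s b hb => ⟨fun α hα μ hμ hμe => ?_, fun ν hν => ?_⟩, hB.exists_finset_ergodic,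
    LevelGraph.exists_telescope_supports hB, ?_⟩
  · obtain ⟨v, -, hv, -⟩ := hα 1 le_rfl
    have hD := LevelGraph.vertical_isBratteli hB (W := b ⁻¹' {α}) ⟨v, hv⟩ (hb.exists_edge hB hα)
    obtain ⟨ν, hν, hνe⟩ := hμe.exists_extension hB hD (hb.noReturn hB α)
    exact ⟨ν, hν, hνe, fun ν' hν' => hν'.unique hB hD (hb.noReturn hB α) hν⟩
  · obtain ⟨α, hα, hsat, hfin⟩ := hb.exists_block hB hν
    obtain ⟨v, -, hv, -⟩ := hα 1 le_rfl
    have hD := LevelGraph.vertical_isBratteli hB (W := b ⁻¹' {α}) ⟨v, hv⟩ (hb.exists_edge hB hα)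
    obtain ⟨hμ, hμe⟩ := hν.comap_verticalIncl hB hD hsat hfin
    exact ⟨α, hα, _, hμ, hμe, hν.invariant, hsat, rfl⟩
  · intro μ hμ _ W _ ρ hρ v hv
    exact hρ.tendsto_tower hv
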